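/- **Setting.** Let $d\ge1$ and $L\ge0$ be integers and let $\Psi_0,\Psi_1\in C_0^\infty(\mathbb R)$ be complex-valued. With $\mathcal F\psi(\xi)=\int\psi(y)e^{-2\pi i\xi y}\,dy$, suppose that for some $\varepsilon>0$: $|\mathcal F\Psi_0(\xi)|>0$ for $|\xi|<\varepsilon$, $|\mathcal F\Psi_1(\xi)|>0$ for $\varepsilon/2<|\xi|<2\varepsilon$, and $D^\alpha\mathcal F\Psi_1(0)=0$ for $0\le\alpha\le L$. Put $\Psi_j(t)=2^{j-1}\Psi_1(2^{j-1}t)$ for $j\ge1$, $\Psi_m(x)=\prod_{i=1}^d\Psi_{m_i}(x_i)$ for $m\in\mathbb N_0^d$, and $(\Psi_m*f)(x)=f(\Psi_m(x-\cdot))$ for $f\in\mathcal S'(\mathbb R^d)$. For $0<p,\theta\le\infty$ and $s<L+1$ let $$\|f\|_{\mathbf B^s_{p,\theta}}=\Big(\sum_{m\in\mathbb N_0^d}2^{s|m|_1\theta}\|\Psi_m*f\|_p^\theta\Big)^{1/\theta},\qquad \|f\|_{\mathbf F^s_{p,\theta}}=\Big\|\Big(\sum_{m\in\mathbb N_0^d}2^{s|m|_1\theta}|\Psi_m*f(\cdot)|^\theta\Big)^{1/\theta}\Big\|_p\quad(p<\infty),$$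 where $\|\cdot\|_p$ is the $L_p(\mathbb R^d)$ (quasi-)norm, with the usual modification if $p=\infty$ or $\theta=\infty$. For $\mathbf A\in\{\mathbf B,\mathbf F\}$ let $\mathbf A^s_{p,\theta}$ be the set of $f\in\mathcal S'(\mathbb R^d)$ with $\|f\|_{\mathbf A^s_{p,\theta}}<\infty$, let $\mathring{\mathbf A}^s_{p,\theta}=\{f\in\mathbf A^s_{p,\theta}:\operatorname{supp}f\subset[0,1]^d\}$, and let $\mathring{\mathbf A}^s_{p,\theta}\cap C(\mathbb R^d)$ be the class of its elements that are bounded continuous functions, equipped with $\|\cdot\|_{\mathbf A^s_{p,\theta}}$. For such a (quasi-)normed class $\mathbf F_d$ of functions and $n\ge1$ put $$\mathrm{Int}_n(\mathbf F_d)=\inf_{x^1,\dots,x^n\in[0,1]^d}\ \inf_{\lambda^1,\dots,\lambda^n\in\mathbb R}\ \sup_{\|f\|_{\mathbf F_d}\le1}\Big|\int_{[0,1]^d}f(x)\,dx-\sum_{i=1}^n\lambda^if(x^i)\Big|\in[0,\infty].$$ Write $a_+=\max\{a,0\}$, $1/\infty=0$, $0^0=1$, and $a_n\gtrsim b_n$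 if there is a constant $c>0$, independent of $n$, with $a_n\ge c\,b_n$ for all $n\ge1$. **Theorem.** Let $0<p,\theta\le\infty$ and $\sigma_p:=\max\{0,1/p-1\}<s<L+1$. Then: (i) $\mathrm{Int}_n\big(\mathring{\mathbf B}^s_{p,\theta}\cap C(\mathbb R^d)\big)\gtrsim n^{-s+(1/p-1)_+}(\log n)^{(d-1)(1-1/\theta)_+}$. (ii) If $1\le p<\infty$, then $\mathrm{Int}_n\big(\mathring{\mathbf F}^s_{p,\theta}\cap C(\mathbb R^d)\big)\gtrsim n^{-s}(\log n)^{(d-1)(1-1/\theta)_+}$. (iii) If $0<p<1$, then $\mathrm{Int}_n\big(\mathring{\mathbf F}^s_{p,\theta}\cap C(\mathbb R^d)\big)\gtrsim n^{-s+1/p-1}$. -/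

import Mathlib

open scoped ENNReal SchwartzMap ContDiff BoundedContinuousFunction FourierTransform

namespace MixedSmoothness

/-- A pair of local-mean kernels `Ψ₀, Ψ₁ ∈ C₀^∞(ℝ)` satisfying the Tauberian conditions for some
`ε > 0`, such that the derivatives of the Fourier transform of `Ψ₁` up to order `L` vanish at `0`.
The Fourier transform is `𝓕 f ξ = ∫ f(y) exp(-2πi ξ y) dy`. -/
structure LocalMeanKernels (L : ℕ) where
  Ψ₀ : ℝ → ℂ
  Ψ₁ : ℝ → ℂ
  smooth₀ : ContDiff ℝ ∞ Ψ₀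
  smooth₁ : ContDiff ℝ ∞ Ψ₁
  compact₀ : HasCompactSupport Ψ₀
  compact₁ : HasCompactSupport Ψ₁
  tauberian : ∃ ε : ℝ, 0 < ε ∧ (∀ ξ : ℝ, |ξ| < ε → 0 < ‖𝓕 Ψ₀ ξ‖) ∧
    (∀ ξ : ℝ, ε / 2 < |ξ| → |ξ| < 2 * ε → 0 < ‖𝓕 Ψ₁ ξ‖)
  moments : ∀ α : ℕ, α ≤ L → iteratedDeriv α (𝓕 Ψ₁) 0 = 0

namespace LocalMeanKernels

variable {L : ℕ} (K : LocalMeanKernels L)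

/-- The dyadic dilates: `Ψ_0` itself, and `Ψ_j(t) = 2^(j-1) Ψ₁(2^(j-1) t)` for `j ≥ 1`. -/
noncomputable def dilate : ℕ → ℝ → ℂ
  | 0 => K.Ψ₀
  | j + 1 => fun t => (2 : ℂ) ^ j * K.Ψ₁ ((2 : ℝ) ^ j * t)

/-- The tensorized kernel `Ψ_m(x) = ∏ i, Ψ_{m_i}(x_i)`. -/
noncomputable def tensor {d : ℕ} (m : Fin d → ℕ) (x : Fin d → ℝ) : ℂ :=
  ∏ i, K.dilate (m i) (x i)

theorem contDiff_dilate (j : ℕ) : ContDiff ℝ ∞ (K.dilate j) := by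
  cases j with
  | zero => exact K.smooth₀
  | succ j => exact contDiff_const.mul (K.smooth₁.comp (contDiff_const.mul contDiff_id))

theorem hasCompactSupport_dilate (j : ℕ) : HasCompactSupport (K.dilate j) := by
  cases j with
  | zero => exact K.compact₀
  | succ j =>
    have h : HasCompactSupport (fun t : ℝ => K.Ψ₁ ((2 : ℝ) ^ j * t)) :=
      K.compact₁.comp_homeomorph (Homeomorph.mulLeft₀ ((2 : ℝ) ^ j) (by positivity))
    exact h.mul_left

theorem contDiff_tensor {d : ℕ} (m : Fin d → ℕ) :
    ContDiff ℝ ∞ (K.tensor m : (Fin d → ℝ) → ℂ) :=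
  contDiff_prod fun i _ => (K.contDiff_dilate (m i)).comp (contDiff_apply ℝ ℝ i)

theorem hasCompactSupport_tensor {d : ℕ} (m : Fin d → ℕ) :
    HasCompactSupport (K.tensor m : (Fin d → ℝ) → ℂ) := by
  refine HasCompactSupport.intro (isCompact_univ_pi fun i => K.hasCompactSupport_dilate (m i)) ?_
  intro x hx
  simp only [Set.mem_pi, Set.mem_univ, true_implies, not_forall] at hx
  obtain ⟨i, hi⟩ := hx
  exact Finset.prod_eq_zero (Finset.mem_univ i) (image_eq_zero_of_notMem_tsupport hi)

/-- The test function `y ↦ Ψ_m(x - y)`. -/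
noncomputable def translate {d : ℕ} (m : Fin d → ℕ) (x : Fin d → ℝ) : 𝓢(Fin d → ℝ, ℂ) :=
  HasCompactSupport.toSchwartzMap (f := fun y => K.tensor m (x - y))
    ((K.hasCompactSupport_tensor m).comp_homeomorph (Homeomorph.subLeft x))
    ((K.contDiff_tensor m).comp (contDiff_const.sub contDiff_id))

/-- The local mean `(Ψ_m ∗ f)(x) = f(Ψ_m(x - ·))` of a tempered distribution `f`. -/
noncomputable def localMean {d : ℕ} (m : Fin d → ℕ) (f : 𝓢'(Fin d → ℝ, ℂ))
    (x : Fin d → ℝ) : ℂ :=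
  f (K.translate m x)

end LocalMeanKernels

/-- The `ℓ_θ` (quasi-)norm of a family of extended nonnegative numbers; the supremum if `θ = ∞`. -/
noncomputable def ellNorm {ι : Type*} (θ : ℝ≥0∞) (a : ι → ℝ≥0∞) : ℝ≥0∞ :=
  if θ = ⊤ then ⨆ i, a i else (∑' i, a i ^ θ.toReal) ^ (1 / θ.toReal)

/-- The weight `2^(s |m|₁)`. -/
noncomputable def weight {d : ℕ} (s : ℝ) (m : Fin d → ℕ) : ℝ≥0∞ :=
  (2 : ℝ≥0∞) ^ (s * ((∑ i, m i : ℕ) : ℝ))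

/-- The Besov (quasi-)norm of dominating mixed smoothness (`∞` outside the space). -/
noncomputable def besovNorm {d L : ℕ} (K : LocalMeanKernels L) (s : ℝ) (p θ : ℝ≥0∞)
    (f : 𝓢'(Fin d → ℝ, ℂ)) : ℝ≥0∞ :=
  ellNorm θ fun m : Fin d → ℕ =>
    weight s m * MeasureTheory.eLpNorm (K.localMean m f) p MeasureTheory.volume

/-- The Triebel-Lizorkin (quasi-)norm of dominating mixed smoothness (`∞` outside the space). -/
noncomputable def triebelLizorkinNorm {d L : ℕ} (K : LocalMeanKernels L) (s : ℝ) (p θ : ℝ≥0∞)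
    (f : 𝓢'(Fin d → ℝ, ℂ)) : ℝ≥0∞ :=
  MeasureTheory.eLpNorm
    (fun x => ellNorm θ fun m : Fin d → ℕ => weight s m * ‖K.localMean m f x‖ₑ)
    p MeasureTheory.volume

/-- The Besov space of dominating mixed smoothness on `ℝ^d`. -/
def besovSpace (d : ℕ) {L : ℕ} (K : LocalMeanKernels L) (s : ℝ) (p θ : ℝ≥0∞) :
    Set 𝓢'(Fin d → ℝ, ℂ) :=
  {f | besovNorm K s p θ f < ⊤}

/-- The Triebel-Lizorkin space of dominating mixed smoothness on `ℝ^d`. -/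
def triebelLizorkinSpace (d : ℕ) {L : ℕ} (K : LocalMeanKernels L) (s : ℝ) (p θ : ℝ≥0∞) :
    Set 𝓢'(Fin d → ℝ, ℂ) :=
  {f | triebelLizorkinNorm K s p θ f < ⊤}

/-- The unit cube `[0,1]^d`. -/
def unitCube (d : ℕ) : Set (Fin d → ℝ) := Set.Icc 0 1

/-- The distributions of a class `A` that are supported in the unit cube. -/
def supportedInCube {d : ℕ} (A : Set 𝓢'(Fin d → ℝ, ℂ)) : Set 𝓢'(Fin d → ℝ, ℂ) :=
  {f | f ∈ A ∧ Distribution.dsupport f ⊆ unitCube d}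

/-- The tempered distribution `φ ↦ ∫ φ f` given by a bounded continuous function `f`. -/
noncomputable def toDistribution {d : ℕ} (f : (Fin d → ℝ) →ᵇ ℂ) : 𝓢'(Fin d → ℝ, ℂ) :=
  MeasureTheory.Lp.toTemperedDistribution
    ((MeasureTheory.memLp_top_of_bound (μ := MeasureTheory.volume)
      f.continuous.aestronglyMeasurable ‖f‖ (.of_forall f.norm_coe_le_norm)).toLp f)

theorem toDistribution_apply {d : ℕ} (f : (Fin d → ℝ) →ᵇ ℂ) (φ : 𝓢(Fin d → ℝ, ℂ)) :
    toDistribution f φ = ∫ x, φ x * f x := by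
  rw [toDistribution, MeasureTheory.Lp.toTemperedDistribution_apply]
  refine MeasureTheory.integral_congr_ae ?_
  filter_upwards [MeasureTheory.MemLp.coeFn_toLp (MeasureTheory.memLp_top_of_bound
    (μ := MeasureTheory.volume) f.continuous.aestronglyMeasurable ‖f‖
    (.of_forall f.norm_coe_le_norm))] with x hx
  rw [hx, smul_eq_mul]

/-- `A ∩ C(ℝ^d)`: the bounded continuous functions whose distribution belongs to `A`. -/
noncomputable def continuousPart {d : ℕ} (A : Set 𝓢'(Fin d → ℝ, ℂ)) :
    Set ((Fin d → ℝ) →ᵇ ℂ) :=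
  {f | toDistribution f ∈ A}

/-- The optimal worst-case error `Int_n` over all cubature rules with `n` nodes in the unit cube and
real weights, on the unit ball of a class `F` with (quasi-)norm `N`. It takes values in `[0, ∞]`. -/
noncomputable def optimalError {d : ℕ} (F : Set ((Fin d → ℝ) →ᵇ ℂ))
    (N : ((Fin d → ℝ) →ᵇ ℂ) → ℝ≥0∞) (n : ℕ) : ℝ≥0∞ :=
  ⨅ x : Fin n → unitCube d, ⨅ w : Fin n → ℝ, ⨆ f ∈ {f | f ∈ F ∧ N f ≤ 1},
    ‖(∫ y in unitCube d, f y) - ∑ i, (w i : ℂ) * f (x i : Fin d → ℝ)‖ₑ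

/-- `Int_n` for the continuous functions in the Besov class supported in the unit cube. -/
noncomputable def besovInt (d : ℕ) {L : ℕ} (K : LocalMeanKernels L) (s : ℝ) (p θ : ℝ≥0∞)
    (n : ℕ) : ℝ≥0∞ :=
  optimalError (continuousPart (supportedInCube (besovSpace d K s p θ)))
    (fun f => besovNorm K s p θ (toDistribution f)) n

/-- `Int_n` for the continuous functions in the Triebel-Lizorkin class supported in the unit
cube. -/
noncomputable def triebelLizorkinInt (d : ℕ) {L : ℕ} (K : LocalMeanKernels L) (s : ℝ)
    (p θ : ℝ≥0∞) (n : ℕ) : ℝ≥0∞ :=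
  optimalError (continuousPart (supportedInCube (triebelLizorkinSpace d K s p θ)))
    (fun f => triebelLizorkinNorm K s p θ (toDistribution f)) n

/-- The reciprocal `1/p` of an exponent `0 < p ≤ ∞`, with `1/∞ = 0`. -/
noncomputable def recip (p : ℝ≥0∞) : ℝ := (1 / p).toReal

end MixedSmoothness

namespace MixedSmoothness

open MeasureTheory Set

/-! ### Approximation of smooth functions by polynomials -/

/-! The proof uses fooling functions. Given `n` nodes, take `M = order n`, so that `2n < 2^M ≤ 4n`.
For each scale `k` with `|k|₁ = M` there are `2^M` dyadic boxes in the cube, and a node meets the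
open bump of at most one of them; hence more than half of the boxes carry a bump that vanishes at
every node (`two_pow_le_card_emptyBoxes_add`). A nonnegative combination of such bumps makes every
cubature rule return `0`, so the error is at least its integral divided by its norm
(`le_optimalError`).

Let `S` be a set of scales of order `M`. Using all empty boxes of each scale, the integral is of
order `|S|` and both norms are `O(2^(sM) |S|^(1/θ))` (`exists_norm_bumpSum_le`). Using one empty box
per scale, the integral is of order `|S| 2^(-M)` and, for `p ≤ 1`, the Besov norm is `O(2^((s-1/p)M)
|S|^(1/θ))` (`exists_besovNorm_bumpSum_singleton_le`); this is the better choice when `p < 1`. Both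
quotients carry the factor `|S|^(1-1/θ)`, so `S` is taken with about `M^(d-1)` elements if `θ ≥ 1`
and with one element otherwise, which produces the logarithm. Part (iii) needs just one bump
(`exists_triebelLizorkinNorm_bumpSum_singleton_le`).

The norm bounds rest on almost orthogonality of scales. In one dimension the local mean of scale `m`
of a bump of scale `k` is `O(2^(-(L+1)(m-k)))` for `m ≥ k`, by vanishing moments, and `O(2^(m-k))`
for `m < k`, by size. After weighting by `2^(sm)`, and counting overlaps or measuring supports, this
decays geometrically in `|m-k|` (`exists_rpow_mul_decay_le`). Tensorized, each scale in `S` produces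
a peak at `m = k`, and the `ℓ_θ` norm of a sum of `|S|` peaks is `O(|S|^(1/θ))`
(`exists_ellNorm_sum_peak_rpow_le`). -/

theorem exists_abs_sub_sum_pow_le (n : ℕ) (C : ℝ) (g : ℝ → ℝ) (hg : ContDiff ℝ ∞ g)
    (hC : ∀ x, |iteratedDeriv n g x| ≤ C) :
    ∃ a : ℕ → ℝ, ∀ u, |g u - ∑ j ∈ Finset.range n, a j * u ^ j| ≤ C * |u| ^ n := by
  induction n generalizing g with
  | zero => exact ⟨0, fun u => by simpa using hC u⟩
  | succ n ih =>
    have hg' : ContDiff ℝ ∞ (deriv g) := (contDiff_infty_iff_deriv.1 hg).2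
    obtain ⟨a, ha⟩ := ih (deriv g) hg' fun x => by
      have := hC x
      rwa [iteratedDeriv_succ'] at this
    -- The polynomial is the antiderivative of the one found for `deriv g`, with constant term `g
    -- 0`. The mean value inequality on the segment from `0` to `u` then gains one factor `|u|`.
    refine ⟨fun j => if j = 0 then g 0 else a (j - 1) / j, fun u => ?_⟩
    have hder : ∀ x, HasDerivAt (fun u => g u - ∑ j ∈ Finset.range n, a j / (j + 1) * u ^ (j + 1))
        (deriv g x - ∑ j ∈ Finset.range n, a j * x ^ j) x := by
      intro x
      refine ((hg.differentiable (by simp)) x).hasDerivAt.sub (HasDerivAt.fun_sum fun j _ => ?_)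
      have h := (hasDerivAt_pow (j + 1) x).const_mul (a j / (j + 1))
      refine h.congr_deriv ?_
      push_cast
      field_simp
    have key := Convex.norm_image_sub_le_of_norm_hasDerivWithin_le (𝕜 := ℝ)
      (s := uIcc 0 u) (x := 0) (y := u) (C := C * |u| ^ n)
      (fun x _ => (hder x).hasDerivWithinAt) (fun x hx => ?_) (convex_uIcc 0 u)
      left_mem_uIcc right_mem_uIcc
    · rw [Finset.sum_range_succ']
      simp only [Real.norm_eq_abs, sub_zero] at key
      have h0 : ∑ j ∈ Finset.range n, a j / ((j : ℝ) + 1) * (0 : ℝ) ^ (j + 1) = 0 := by simp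
      rw [h0, sub_zero] at key
      have e : C * |u| ^ (n + 1) = C * |u| ^ n * |u| := by ring
      rw [e]
      refine le_of_eq_of_le ?_ key
      congr 1
      simp
      ring
    · refine (ha x).trans ?_
      have h1 : |x| ≤ |u| := by
        rcases le_total 0 u with h | h
        · rw [uIcc_of_le h] at hx
          rw [abs_of_nonneg hx.1, abs_of_nonneg h]
          exact hx.2
        · rw [uIcc_of_ge h] at hx
          rw [abs_of_nonpos hx.2, abs_of_nonpos h]
          linarith [hx.1]
      have hC0 : 0 ≤ C := (abs_nonneg _).trans (hC 0)
      gcongr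

/-! ### The bump function -/

theorem exists_bump : ∃ f : ℝ → ℝ, Function.support f = Ioo 0 1 ∧ ContDiff ℝ ∞ f ∧
    range f ⊆ Icc 0 1 :=
  (isOpen_Ioo (a := (0 : ℝ)) (b := 1)).exists_contDiff_support_eq (n := ⊤)

/-- A smooth function with values in `[0, 1]` that is positive exactly on `(0, 1)`. -/
noncomputable def bump : ℝ → ℝ := exists_bump.choose

theorem support_bump : Function.support bump = Ioo 0 1 := exists_bump.choose_spec.1

theorem contDiff_bump : ContDiff ℝ ∞ bump := exists_bump.choose_spec.2.1

theorem continuous_bump : Continuous bump := contDiff_bump.continuous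

theorem bump_nonneg (x : ℝ) : 0 ≤ bump x := (exists_bump.choose_spec.2.2 ⟨x, rfl⟩).1

theorem bump_le_one (x : ℝ) : bump x ≤ 1 := (exists_bump.choose_spec.2.2 ⟨x, rfl⟩).2

theorem bump_ne_zero_iff {x : ℝ} : bump x ≠ 0 ↔ x ∈ Ioo 0 1 := by
  rw [← support_bump, Function.mem_support]

theorem hasCompactSupport_bump : HasCompactSupport bump := by
  refine HasCompactSupport.intro (isCompact_Icc (a := (0 : ℝ)) (b := 1)) fun x hx => ?_
  by_contra h
  exact hx (Ioo_subset_Icc_self (bump_ne_zero_iff.1 h))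

theorem integrable_bump : Integrable bump :=
  continuous_bump.integrable_of_hasCompactSupport hasCompactSupport_bump

theorem integral_bump_pos : 0 < ∫ x, bump x := by
  rw [integral_pos_iff_support_of_nonneg bump_nonneg integrable_bump, support_bump]
  simp

theorem exists_abs_iteratedDeriv_bump_le (n : ℕ) : ∃ C, ∀ x, |iteratedDeriv n bump x| ≤ C := by
  obtain ⟨C, hC⟩ := (hasCompactSupport_bump.iteratedFDeriv (𝕜 := ℝ) n).exists_bound_of_continuous
    (contDiff_bump.continuous_iteratedFDeriv (by exact_mod_cast le_top))
  exact ⟨C, fun x => by simpa [norm_iteratedFDeriv_eq_norm_iteratedDeriv] using hC x⟩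

theorem integral_bump_affine (k : ℕ) (b : ℝ) :
    ∫ y, bump (2 ^ k * y - b) = (2 ^ k)⁻¹ * ∫ x, bump x := by
  have h := Measure.integral_comp_mul_left (fun y => bump (y - b)) ((2 : ℝ) ^ k)
  rw [h, integral_sub_right_eq_self bump b, abs_of_pos (by positivity), smul_eq_mul]

theorem integrable_bump_affine (k : ℕ) (b : ℝ) :
    Integrable fun y => bump (2 ^ k * y - b) :=
  Integrable.comp_mul_left' (g := fun y => bump (y - b)) (integrable_bump.comp_sub_right b)
    (by positivity)

namespace LocalMeanKernels

variable {L : ℕ} (K : LocalMeanKernels L)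

/-! ### One-dimensional local means of dilated bumps -/

/-- The local mean of the bump `y ↦ bump (2^k y - l)`. -/
noncomputable def bumpMean (m k l : ℕ) (t : ℝ) : ℂ :=
  ∫ y, K.dilate m (t - y) * (bump (2 ^ k * y - l) : ℂ)

theorem continuous_dilate (m : ℕ) : Continuous (K.dilate m) := (K.contDiff_dilate m).continuous

/-- Differentiating the Fourier integral `α` times at `0` yields `(-2πi)^α` times the moment. -/
theorem integral_pow_mul_eq_zero {α : ℕ} (hα : α ≤ L) : ∫ v : ℝ, (v : ℂ) ^ α * K.Ψ₁ v = 0 := by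
  have h := K.moments α hα
  rw [Real.iteratedDeriv_fourier (N := ⊤) ?_ le_top, Real.fourier_eq] at h
  · simp only [inner_zero_right, neg_zero, AddChar.map_zero_eq_one, one_smul, mul_pow,
      smul_eq_mul, mul_assoc] at h
    rw [integral_const_mul, integral_const_mul, integral_const_mul] at h
    simpa [Real.pi_ne_zero] using h
  · intro n _
    refine Continuous.integrable_of_hasCompactSupport (by
      have := K.smooth₁.continuous
      fun_prop) ?_
    exact K.compact₁.smul_left

theorem exists_norm_dilate_le : ∃ C, 0 < C ∧ ∀ m t, ‖K.dilate m t‖ ≤ C * 2 ^ m := by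
  obtain ⟨C₀, h₀⟩ := K.compact₀.exists_bound_of_continuous K.smooth₀.continuous
  obtain ⟨C₁, h₁⟩ := K.compact₁.exists_bound_of_continuous K.smooth₁.continuous
  refine ⟨max 1 (max C₀ C₁), by positivity, fun m t => ?_⟩
  cases m with
  | zero => simpa [dilate] using Or.inr (Or.inl (h₀ t))
  | succ j =>
    simp only [dilate, norm_mul, norm_pow, Complex.norm_ofNat]
    have h := h₁ (2 ^ j * t)
    have hC : C₁ ≤ max 1 (max C₀ C₁) := by simp
    have h0 : (0 : ℝ) ≤ max 1 (max C₀ C₁) := by positivity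
    calc (2 : ℝ) ^ j * ‖K.Ψ₁ (2 ^ j * t)‖ ≤ 2 ^ j * max 1 (max C₀ C₁) := by
          gcongr
          exact h.trans hC
      _ ≤ 2 ^ (j + 1) * max 1 (max C₀ C₁) := by
          gcongr <;> simp
      _ = _ := mul_comm _ _

theorem exists_abs_le_of_dilate_ne_zero :
    ∃ R, 0 < R ∧ ∀ m t, K.dilate m t ≠ 0 → |t| ≤ R / 2 ^ m := by
  obtain ⟨R₀, h₀⟩ := K.compact₀.isCompact.isBounded.exists_norm_le
  obtain ⟨R₁, h₁⟩ := K.compact₁.isCompact.isBounded.exists_norm_le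
  -- The factor `2` on `R₁` is there because `dilate (j + 1)` scales by `2 ^ j`, not `2 ^ (j + 1)`.
  refine ⟨max 1 (max R₀ (2 * R₁)), by positivity, fun m t ht => ?_⟩
  rw [le_div_iff₀ (by positivity)]
  cases m with
  | zero =>
    have := h₀ t (subset_tsupport _ ht)
    simpa using Or.inr (Or.inl this)
  | succ j =>
    have h := h₁ (2 ^ j * t) (subset_tsupport _ (right_ne_zero_of_mul ht))
    rw [norm_mul, norm_pow, Real.norm_eq_abs, Real.norm_eq_abs, abs_two] at h
    refine le_max_of_le_right (le_max_of_le_right ?_)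
    rw [pow_succ]
    linarith

theorem integrable_bumpMean (m k l : ℕ) (t : ℝ) :
    Integrable fun y => K.dilate m (t - y) * (bump (2 ^ k * y - l) : ℂ) := by
  refine Continuous.integrable_of_hasCompactSupport ?_ ?_
  · have := K.continuous_dilate m
    have := continuous_bump
    fun_prop
  · exact ((K.hasCompactSupport_dilate m).comp_homeomorph (Homeomorph.subLeft t)).mul_right

/-- The substitution `v = 2^j (t - y)` brings the kernel to unit scale, so that its moments can act
on a Taylor polynomial of the bump with small parameter `2^k / 2^j`. -/
theorem bumpMean_succ (j k l : ℕ) (t : ℝ) : K.bumpMean (j + 1) k l t =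
    ∫ v, K.Ψ₁ v * (bump (2 ^ k * t - l - 2 ^ k / 2 ^ j * v) : ℂ) := by
  rw [bumpMean]
  have e1 := integral_sub_left_eq_self
    (fun u => K.dilate (j + 1) u * (bump (2 ^ k * (t - u) - l) : ℂ)) volume t
  simp only [sub_sub_cancel] at e1
  rw [e1]
  have e2 := Measure.integral_comp_mul_left
    (fun v => (2 : ℂ) ^ j * (K.Ψ₁ v * (bump (2 ^ k * t - l - 2 ^ k / 2 ^ j * v) : ℂ)))
    ((2 : ℝ) ^ j)
  have e3 : |((2 : ℝ) ^ j)⁻¹| • ∫ v, (2 : ℂ) ^ j *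
      (K.Ψ₁ v * (bump (2 ^ k * t - l - 2 ^ k / 2 ^ j * v) : ℂ)) =
      ∫ v, K.Ψ₁ v * (bump (2 ^ k * t - l - 2 ^ k / 2 ^ j * v) : ℂ) := by
    rw [integral_const_mul, abs_of_pos (by positivity), Complex.real_smul, ← mul_assoc]
    push_cast
    rw [inv_mul_cancel₀ (pow_ne_zero _ two_ne_zero), one_mul]
  rw [← e3, ← e2]
  refine integral_congr_ae (.of_forall fun u => ?_)
  have e4 : (2 : ℝ) ^ k * (t - u) - l = 2 ^ k * t - l - 2 ^ k / 2 ^ j * (2 ^ j * u) := by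
    field_simp
    ring
  simp only [dilate, mul_assoc, e4]

/-- Vanishing moments remove a polynomial of degree at most `L` from the bump; what remains is of
size `(2^k / 2^j · |v|)^(L+1)`, integrable against the compactly supported kernel. -/
theorem exists_norm_bumpMean_le_of_moments : ∃ C, 0 < C ∧ ∀ j k l t,
    ‖K.bumpMean (j + 1) k l t‖ ≤ C * (2 ^ k / 2 ^ (j + 1)) ^ (L + 1) := by
  obtain ⟨B, hB⟩ := exists_abs_iteratedDeriv_bump_le (L + 1)
  have hB0 : 0 ≤ B := (abs_nonneg _).trans (hB 0)
  have hcont := K.smooth₁.continuous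
  set M := ∫ v, ‖K.Ψ₁ v‖ * |v| ^ (L + 1) with hM
  have hM0 : 0 ≤ M := integral_nonneg fun v => by positivity
  have hint : Integrable fun v : ℝ => ‖K.Ψ₁ v‖ * |v| ^ (L + 1) :=
    Continuous.integrable_of_hasCompactSupport (by fun_prop) K.compact₁.norm.mul_right
  -- The factor `2 ^ (L + 1)` pays for replacing `2 ^ j` by `2 ^ (j + 1)`; the `+ 1` only makes the
  -- constant positive.
  refine ⟨2 ^ (L + 1) * (B * M) + 1, by positivity, fun j k l t => ?_⟩
  set τ : ℝ := 2 ^ k * t - l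
  set r : ℝ := 2 ^ k / 2 ^ j with hr
  obtain ⟨a, ha⟩ := exists_abs_sub_sum_pow_le (L + 1) B (fun w => bump (τ - w))
    (contDiff_bump.comp (contDiff_const.sub contDiff_id)) fun x => by
      rw [iteratedDeriv_comp_const_sub]
      simpa [abs_mul] using hB (τ - x)
  have hzero : ∫ v, K.Ψ₁ v * ((∑ i ∈ Finset.range (L + 1), a i * (r * v) ^ i : ℝ) : ℂ) = 0 := by
    have e : ∀ v : ℝ, K.Ψ₁ v * ((∑ i ∈ Finset.range (L + 1), a i * (r * v) ^ i : ℝ) : ℂ) =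
        ∑ i ∈ Finset.range (L + 1), ((a i : ℂ) * (r : ℂ) ^ i) * ((v : ℂ) ^ i * K.Ψ₁ v) := by
      intro v
      push_cast
      rw [Finset.mul_sum]
      refine Finset.sum_congr rfl fun i _ => ?_
      ring
    simp_rw [e]
    rw [integral_finsetSum]
    · refine Finset.sum_eq_zero fun i hi => ?_
      rw [integral_const_mul, K.integral_pow_mul_eq_zero (by simpa [Nat.lt_succ_iff] using hi),
        mul_zero]
    · intro i _
      exact Continuous.integrable_of_hasCompactSupport (by fun_prop)
        (K.compact₁.mul_left.mul_left)
  have hrew : K.bumpMean (j + 1) k l t = ∫ v, K.Ψ₁ v *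
      ((bump (τ - r * v) - ∑ i ∈ Finset.range (L + 1), a i * (r * v) ^ i : ℝ) : ℂ) := by
    simp only [Complex.ofReal_sub, mul_sub]
    rw [integral_sub, hzero, sub_zero, bumpMean_succ]
    · refine Continuous.integrable_of_hasCompactSupport ?_ K.compact₁.mul_right
      have := continuous_bump
      fun_prop
    · refine Continuous.integrable_of_hasCompactSupport ?_ K.compact₁.mul_right
      fun_prop
  have hle : ‖K.bumpMean (j + 1) k l t‖ ≤ ∫ v, B * r ^ (L + 1) * (‖K.Ψ₁ v‖ * |v| ^ (L + 1)) := by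
    rw [hrew]
    refine norm_integral_le_of_norm_le (hint.const_mul _) (.of_forall fun v => ?_)
    rw [norm_mul, Complex.norm_real, Real.norm_eq_abs]
    have h := ha (r * v)
    have hr0 : 0 ≤ r := by positivity
    rw [abs_mul, abs_of_nonneg hr0] at h
    calc _ ≤ ‖K.Ψ₁ v‖ * (B * (r * |v|) ^ (L + 1)) := by gcongr
      _ = _ := by rw [mul_pow]; ring
  rw [integral_const_mul, ← hM] at hle
  have hr2 : r = 2 * (2 ^ k / 2 ^ (j + 1)) := by
    rw [hr, pow_succ]
    field_simp
  rw [hr2, mul_pow] at hle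
  refine hle.trans ?_
  have : (0 : ℝ) ≤ (2 ^ k / 2 ^ (j + 1)) ^ (L + 1) := by positivity
  nlinarith

/-- The rate at which the local mean of scale `m` of a bump of scale `k` decays. -/
noncomputable def decay (L m k : ℕ) : ℝ :=
  if k ≤ m then (2 ^ k / 2 ^ m) ^ (L + 1) else 2 ^ m / 2 ^ k

theorem decay_pos (L m k : ℕ) : 0 < decay L m k := by
  unfold decay
  split_ifs <;> positivity

/-- For `k > m` the kernel is at most a constant times `2^m` and the bump has mass of order
`2^(-k)`; for `k ≤ m` the moments are used. -/
theorem exists_norm_bumpMean_le :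
    ∃ C, 0 < C ∧ ∀ m k l t, ‖K.bumpMean m k l t‖ ≤ C * decay L m k := by
  obtain ⟨C₁, hC₁, h₁⟩ := K.exists_norm_dilate_le
  obtain ⟨C₂, hC₂, h₂⟩ := K.exists_norm_bumpMean_le_of_moments
  have hI := integral_bump_pos
  have hcoarse : ∀ m k l t, ‖K.bumpMean m k l t‖ ≤ C₁ * (∫ x, bump x) * (2 ^ m / 2 ^ k) := by
    intro m k l t
    have h : ‖K.bumpMean m k l t‖ ≤ ∫ y, C₁ * 2 ^ m * bump (2 ^ k * y - l) := by
      refine norm_integral_le_of_norm_le ((integrable_bump_affine k l).const_mul _)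
        (.of_forall fun y => ?_)
      rw [norm_mul, Complex.norm_real, Real.norm_eq_abs, abs_of_nonneg (bump_nonneg _)]
      exact mul_le_mul_of_nonneg_right (h₁ m _) (bump_nonneg _)
    rw [integral_const_mul, integral_bump_affine] at h
    refine h.trans_eq ?_
    ring
  refine ⟨C₁ * (∫ x, bump x) + C₂, by positivity, fun m k l t => ?_⟩
  have hpos := (decay_pos L m k).le
  by_cases hkm : k ≤ m
  · have hd : decay L m k = (2 ^ k / 2 ^ m) ^ (L + 1) := if_pos hkm
    cases m with
    -- `Ψ₀` has no moment condition, but here `k = 0` and the size bound is already of the right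
    -- order.
    | zero =>
      obtain rfl : k = 0 := by omega
      refine (hcoarse _ _ _ _).trans ?_
      simp only [hd, pow_zero, div_one, one_pow, mul_one]
      linarith
    | succ j =>
      refine (h₂ j k l t).trans ?_
      rw [← hd]
      have : 0 ≤ C₁ * (∫ x, bump x) := by positivity
      nlinarith
  · refine (hcoarse _ _ _ _).trans ?_
    have hd : decay L m k = 2 ^ m / 2 ^ k := if_neg hkm
    rw [← hd]
    nlinarith

theorem exists_abs_sub_le_of_bumpMean_ne_zero : ∃ R, 1 ≤ R ∧ ∀ m k l t,
    K.bumpMean m k l t ≠ 0 → |t - l / 2 ^ k| ≤ R / 2 ^ min m k := by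
  obtain ⟨R, hR, h⟩ := K.exists_abs_le_of_dilate_ne_zero
  refine ⟨R + 1, by linarith, fun m k l t ht => ?_⟩
  obtain ⟨y, hy⟩ : ∃ y, K.dilate m (t - y) * (bump (2 ^ k * y - l) : ℂ) ≠ 0 := by
    by_contra! hc
    exact ht (by simp [bumpMean, hc])
  have h1 := h m _ (left_ne_zero_of_mul hy)
  have h2 : bump (2 ^ k * y - l) ≠ 0 := by
    have := right_ne_zero_of_mul hy
    exact_mod_cast this
  rw [bump_ne_zero_iff] at h2
  have h3 : |y - l / 2 ^ k| ≤ 1 / 2 ^ k := by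
    have : y - l / 2 ^ k = (2 ^ k * y - l) / 2 ^ k := by field_simp
    rw [this, abs_div, abs_of_pos h2.1, abs_of_pos (by positivity : (0 : ℝ) < 2 ^ k)]
    gcongr
    exact h2.2.le
  have h4 : R / 2 ^ m ≤ R / 2 ^ min m k := by
    gcongr
    · norm_num
    · exact min_le_left _ _
  have h5 : (1 : ℝ) / 2 ^ k ≤ 1 / 2 ^ min m k := by
    gcongr
    · norm_num
    · exact min_le_right _ _
  calc |t - l / 2 ^ k| ≤ |t - y| + |y - l / 2 ^ k| := abs_sub_le _ _ _
    _ ≤ (R + 1) / 2 ^ min m k := by rw [add_div]; linarith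

/-- At most `O(2^(k-m))` dyadic bumps of scale `k` are seen by a local mean of scale `m`. -/
theorem card_filter_abs_sub_le {R : ℝ} (hR : 1 ≤ R) (k j : ℕ) (hj : j ≤ k) (t : ℝ)
    (s : Finset ℕ) : (({l ∈ s | |t - (l : ℕ) / 2 ^ k| ≤ R / 2 ^ j} : Finset ℕ).card : ℝ) ≤
      3 * R * (2 ^ k / 2 ^ j) := by
  set ρ : ℝ := R * (2 ^ k / 2 ^ j) with hρ
  have hone : (1 : ℝ) ≤ 2 ^ k / 2 ^ j := by
    rw [one_le_div (by positivity)]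
    exact pow_le_pow_right₀ (by norm_num) hj
  -- An interval of length `2ρ` holds at most `2ρ + 1` integers, and `ρ ≥ 1` turns this into `3ρ`.
  have hρ1 : 1 ≤ ρ := by nlinarith
  have hsub : ({l ∈ s | |t - (l : ℕ) / 2 ^ k| ≤ R / 2 ^ j} : Finset ℕ).image (fun l : ℕ => (l : ℤ)) ⊆
      Finset.Icc ⌈2 ^ k * t - ρ⌉ ⌊2 ^ k * t + ρ⌋ := by
    intro z hz
    obtain ⟨l, hl, rfl⟩ := Finset.mem_image.1 hz
    have h := (Finset.mem_filter.1 hl).2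
    have h' : |2 ^ k * t - l| ≤ ρ := by
      have : 2 ^ k * t - l = 2 ^ k * (t - l / 2 ^ k) := by field_simp
      rw [this, abs_mul, abs_of_pos (by positivity : (0 : ℝ) < 2 ^ k)]
      calc (2 : ℝ) ^ k * |t - l / 2 ^ k| ≤ 2 ^ k * (R / 2 ^ j) := by gcongr
        _ = ρ := by rw [hρ]; ring
    rw [abs_le] at h'
    rw [Finset.mem_Icc, Int.ceil_le, Int.le_floor]
    push_cast
    constructor <;> linarith
  have hcard := Finset.card_le_card hsub
  rw [Finset.card_image_of_injective _ Nat.cast_injective, Int.card_Icc] at hcard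
  have h1 : ((⌊2 ^ k * t + ρ⌋ + 1 - ⌈2 ^ k * t - ρ⌉).toNat : ℝ) ≤ 2 * ρ + 1 := by
    have h2 := Int.floor_le (2 ^ k * t + ρ)
    have h3 := Int.le_ceil (2 ^ k * t - ρ)
    rcases le_total 0 (⌊2 ^ k * t + ρ⌋ + 1 - ⌈2 ^ k * t - ρ⌉) with h | h
    · have : ((⌊2 ^ k * t + ρ⌋ + 1 - ⌈2 ^ k * t - ρ⌉).toNat : ℝ) =
          ((⌊2 ^ k * t + ρ⌋ + 1 - ⌈2 ^ k * t - ρ⌉ : ℤ) : ℝ) := by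
        exact_mod_cast congrArg (Int.cast (R := ℝ)) (Int.toNat_of_nonneg h)
      rw [this]
      push_cast
      linarith
    · rw [Int.toNat_of_nonpos h]
      push_cast
      linarith
  calc _ ≤ ((⌊2 ^ k * t + ρ⌋ + 1 - ⌈2 ^ k * t - ρ⌉).toNat : ℝ) := by exact_mod_cast hcard
    _ ≤ 2 * ρ + 1 := h1
    _ ≤ 3 * R * (2 ^ k / 2 ^ j) := by rw [mul_assoc, ← hρ]; linarith

/-- The uniform bound on one mean is multiplied by the number of translates seen from `t`. -/
theorem exists_sum_norm_bumpMean_le : ∃ C, 0 < C ∧ ∀ m k t (s : Finset ℕ),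
    ∑ l ∈ s, ‖K.bumpMean m k l t‖ ≤ C * (decay L m k * (2 ^ k / 2 ^ min m k)) := by
  obtain ⟨C, hC, h⟩ := K.exists_norm_bumpMean_le
  obtain ⟨R, hR, h'⟩ := K.exists_abs_sub_le_of_bumpMean_ne_zero
  refine ⟨3 * R * C, by positivity, fun m k t s => ?_⟩
  rw [← Finset.sum_filter_add_sum_filter_not s (fun l : ℕ => |t - (l : ℕ) / 2 ^ k| ≤ R / 2 ^ min m k)]
  rw [Finset.sum_eq_zero (s := s.filter fun l : ℕ => ¬ |t - (l : ℕ) / 2 ^ k| ≤ R / 2 ^ min m k), add_zero]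
  · have hd := (decay_pos L m k).le
    calc _ ≤ _ := Finset.sum_le_card_nsmul _ _ (C * decay L m k) fun l _ => h m k l t
      _ ≤ 3 * R * (2 ^ k / 2 ^ min m k) * (C * decay L m k) := by
        rw [nsmul_eq_mul]
        gcongr
        exact card_filter_abs_sub_le hR k _ (min_le_right _ _) t s
      _ = _ := by ring
  · intro l hl
    by_contra hne
    exact (Finset.mem_filter.1 hl).2 (h' m k l t (by simpa using hne))

end LocalMeanKernels

/-! ### Sequence norms -/

theorem recip_eq (θ : ℝ≥0∞) : recip θ = 1 / θ.toReal := by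
  simp [recip]

theorem ellNorm_mono {ι : Type*} (θ : ℝ≥0∞) {a b : ι → ℝ≥0∞} (h : ∀ i, a i ≤ b i) :
    ellNorm θ a ≤ ellNorm θ b := by
  unfold ellNorm
  split_ifs
  · exact iSup_mono h
  · gcongr with i
    exact h i

theorem ellNorm_const_mul {ι : Type*} {θ : ℝ≥0∞} (hθ : θ ≠ 0) (c : ℝ≥0∞) (a : ι → ℝ≥0∞) :
    ellNorm θ (fun i => c * a i) = c * ellNorm θ a := by
  unfold ellNorm
  split_ifs with h
  · rw [ENNReal.mul_iSup]
  · have hθ' : 0 < θ.toReal := ENNReal.toReal_pos hθ h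
    simp_rw [ENNReal.mul_rpow_of_nonneg _ _ hθ'.le]
    rw [ENNReal.tsum_mul_left, ENNReal.mul_rpow_of_nonneg _ _ (by positivity), ← ENNReal.rpow_mul,
      mul_one_div_cancel hθ'.ne', ENNReal.rpow_one]

theorem ellNorm_zero {ι : Type*} {θ : ℝ≥0∞} (hθ : θ ≠ 0) :
    ellNorm θ (fun _ : ι => (0 : ℝ≥0∞)) = 0 := by
  simpa using ellNorm_const_mul (ι := ι) hθ 0 (fun _ => 0)

theorem rpow_sum_le_sum_rpow {ι : Type*} (s : Finset ι) (a : ι → ℝ≥0∞) {q : ℝ} (hq : 0 < q)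
    (hq1 : q ≤ 1) : (∑ i ∈ s, a i) ^ q ≤ ∑ i ∈ s, a i ^ q := by
  classical
  induction s using Finset.induction_on with
  | empty => simp [hq]
  | insert i s hi ih =>
    rw [Finset.sum_insert hi, Finset.sum_insert hi]
    refine (ENNReal.rpow_add_le_add_rpow _ _ hq.le hq1).trans ?_
    gcongr

/-! ### Sums of exponentially decaying tensor products -/

/-- The tensor product of the sequences `m ↦ ρ ^ |m - k|`. -/
noncomputable def peak {d : ℕ} (ρ : ℝ≥0∞) (m k : Fin d → ℕ) : ℝ≥0∞ :=
  ∏ i, ρ ^ Nat.dist (m i) (k i)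

theorem peak_comm {d : ℕ} (ρ : ℝ≥0∞) (m k : Fin d → ℕ) : peak ρ m k = peak ρ k m := by
  simp [peak, Nat.dist_comm]

theorem peak_rpow {d : ℕ} (ρ : ℝ≥0∞) (m k : Fin d → ℕ) {q : ℝ} (hq : 0 ≤ q) :
    peak ρ m k ^ q = peak (ρ ^ q) m k := by
  rw [peak, peak, ← ENNReal.prod_rpow_of_nonneg hq]
  refine Finset.prod_congr rfl fun i _ => ?_
  rw [← ENNReal.rpow_natCast, ← ENNReal.rpow_natCast, ← ENNReal.rpow_mul, ← ENNReal.rpow_mul,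
    mul_comm]

theorem peak_mul {d : ℕ} (ρ τ : ℝ≥0∞) (m k : Fin d → ℕ) :
    peak ρ m k * peak τ m k = peak (ρ * τ) m k := by
  simp [peak, mul_pow, Finset.prod_mul_distrib]

theorem peak_ne_zero {d : ℕ} {ρ : ℝ≥0∞} (hρ : ρ ≠ 0) (m k : Fin d → ℕ) : peak ρ m k ≠ 0 :=
  Finset.prod_ne_zero_iff.2 fun _ _ => pow_ne_zero _ hρ

theorem peak_ne_top {d : ℕ} {ρ : ℝ≥0∞} (hρ : ρ ≠ ⊤) (m k : Fin d → ℕ) : peak ρ m k ≠ ⊤ :=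
  ENNReal.prod_ne_top fun _ _ => ENNReal.pow_ne_top hρ

/-- One geometric series on each side of `k`. For `ρ ≥ 1` the right side is `∞`. -/
theorem tsum_pow_dist_le (ρ : ℝ≥0∞) (k : ℕ) :
    ∑' m, ρ ^ Nat.dist m k ≤ 2 * (1 - ρ)⁻¹ := by
  rw [← Summable.sum_add_tsum_nat_add' (f := fun m => ρ ^ Nat.dist m k) (k := k)
    ENNReal.summable, two_mul]
  gcongr
  · calc ∑ i ∈ Finset.range k, ρ ^ Nat.dist i k
        = ∑ i ∈ Finset.range k, ρ ^ (k - 1 - i + 1) := by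
          refine Finset.sum_congr rfl fun i hi => ?_
          have := Finset.mem_range.1 hi
          rw [Nat.dist_eq_sub_of_le this.le]
          congr 1
          omega
      _ = ∑ i ∈ Finset.range k, ρ ^ (i + 1) := Finset.sum_range_reflect (fun i => ρ ^ (i + 1)) k
      _ ≤ ∑' i, ρ ^ (i + 1) := ENNReal.sum_le_tsum _
      _ ≤ ∑' i, ρ ^ i := ENNReal.tsum_comp_le_tsum_of_injective (add_left_injective 1) (ρ ^ ·)
      _ = (1 - ρ)⁻¹ := ENNReal.tsum_geometric ρ
  · rw [← ENNReal.tsum_geometric]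
    refine ENNReal.tsum_le_tsum fun i => ?_
    rw [Nat.dist_eq_sub_of_le_right (by omega), Nat.add_sub_cancel]

theorem tsum_prod_le {d : ℕ} (f : Fin d → ℕ → ℝ≥0∞) :
    ∑' m : Fin d → ℕ, ∏ i, f i (m i) ≤ ∏ i, ∑' j, f i j := by
  classical
  rw [ENNReal.tsum_eq_iSup_sum]
  refine iSup_le fun s => ?_
  calc ∑ m ∈ s, ∏ i, f i (m i)
      ≤ ∑ m ∈ Fintype.piFinset fun i => s.image (· i), ∏ i, f i (m i) := by
        refine Finset.sum_le_sum_of_subset fun m hm => ?_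
        exact Fintype.mem_piFinset.2 fun i => Finset.mem_image_of_mem _ hm
    _ = ∏ i, ∑ j ∈ s.image (· i), f i j := (Finset.prod_univ_sum _ _).symm
    _ ≤ ∏ i, ∑' j, f i j := Finset.prod_le_prod' fun i _ => ENNReal.sum_le_tsum _

theorem exists_tsum_peak_le (d : ℕ) {ρ : ℝ≥0∞} (hρ : ρ < 1) : ∃ W : ℝ≥0∞, W ≠ ⊤ ∧
    ∀ k : Fin d → ℕ, ∑' m, peak ρ m k ≤ W := by
  refine ⟨(2 * (1 - ρ)⁻¹) ^ d, ENNReal.pow_ne_top (ENNReal.mul_ne_top (by simp) ?_), fun k => ?_⟩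
  · simpa [tsub_eq_zero_iff_le] using hρ
  · refine (tsum_prod_le fun i j => ρ ^ Nat.dist j (k i)).trans ?_
    calc _ ≤ ∏ _i : Fin d, 2 * (1 - ρ)⁻¹ := Finset.prod_le_prod' fun i _ => tsum_pow_dist_le ρ (k i)
      _ = _ := by simp

/-- Peaks at distinct scales hardly interact, so the sum is linear in `|S|` whatever `q` is. For `q
≤ 1` use subadditivity of `x ↦ x^q`; for `q ≥ 1` the inner sum is bounded uniformly in `S`, by
symmetry of `peak`, so `q - 1` of its powers can be pulled out. -/
theorem exists_tsum_sum_peak_rpow_le (d : ℕ) {ρ : ℝ≥0∞} (hρ : ρ < 1) {q : ℝ} (hq : 0 < q) :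
    ∃ C : ℝ≥0∞, C ≠ ⊤ ∧ ∀ S : Finset (Fin d → ℕ),
      ∑' m, (∑ k ∈ S, peak ρ m k) ^ q ≤ C * S.card := by
  have hcomm : ∀ (τ : ℝ≥0∞) (W : ℝ≥0∞) (_ : ∀ k : Fin d → ℕ, ∑' m, peak τ m k ≤ W)
      (S : Finset (Fin d → ℕ)), ∑' m, ∑ k ∈ S, peak τ m k ≤ W * S.card := by
    intro τ W hW S
    rw [Summable.tsum_finsetSum fun _ _ => ENNReal.summable]
    calc _ ≤ ∑ _k ∈ S, W := Finset.sum_le_sum fun k _ => hW k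
      _ = _ := by rw [Finset.sum_const, nsmul_eq_mul, mul_comm]
  rcases le_total q 1 with h1 | h1
  · obtain ⟨W, hW, h⟩ := exists_tsum_peak_le d (ρ := ρ ^ q) (ENNReal.rpow_lt_one hρ hq)
    refine ⟨W, hW, fun S => le_trans ?_ (hcomm _ W h S)⟩
    refine ENNReal.tsum_le_tsum fun m => (rpow_sum_le_sum_rpow _ _ hq h1).trans_eq ?_
    simp_rw [peak_rpow ρ _ _ hq.le]
  · obtain ⟨W, hW, h⟩ := exists_tsum_peak_le d hρ
    refine ⟨W ^ (q - 1) * W,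
      ENNReal.mul_ne_top (ENNReal.rpow_ne_top_of_nonneg (by linarith) hW) hW, fun S => ?_⟩
    rw [mul_assoc]
    refine le_trans ?_ (mul_le_mul_right (hcomm _ W h S) _)
    rw [← ENNReal.tsum_mul_left]
    refine ENNReal.tsum_le_tsum fun m => ?_
    have hm : ∑ k ∈ S, peak ρ m k ≤ W := by
      refine le_trans ?_ (h m)
      simp_rw [peak_comm ρ m]
      exact ENNReal.sum_le_tsum _
    calc (∑ k ∈ S, peak ρ m k) ^ q = (∑ k ∈ S, peak ρ m k) ^ ((q - 1) + 1) := by ring_nf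
      _ = (∑ k ∈ S, peak ρ m k) ^ (q - 1) * ∑ k ∈ S, peak ρ m k := by
        rw [ENNReal.rpow_add_of_nonneg _ _ (by linarith) zero_le_one, ENNReal.rpow_one]
      _ ≤ _ := by
        gcongr

/-- The source of the factor `|S|^(1/θ)`. The exponent `r` is `1` when contributions add pointwise,
and `1/p` when their `p`-th powers add. -/
theorem exists_ellNorm_sum_peak_rpow_le (d : ℕ) {ρ : ℝ≥0∞} (hρ : ρ < 1) {r : ℝ} (hr : 0 < r)
    {θ : ℝ≥0∞} (hθ : θ ≠ 0) :
    ∃ C : ℝ≥0∞, C ≠ ⊤ ∧ ∀ S : Finset (Fin d → ℕ),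
      ellNorm θ (fun m => (∑ k ∈ S, peak ρ m k) ^ r) ≤ C * (S.card : ℝ≥0∞) ^ recip θ := by
  by_cases hθt : θ = ⊤
  · obtain ⟨W, hW, h⟩ := exists_tsum_peak_le d hρ
    refine ⟨W ^ r, ENNReal.rpow_ne_top_of_nonneg hr.le hW, fun S => ?_⟩
    simp only [ellNorm, hθt, if_true, recip, ENNReal.div_top, ENNReal.toReal_zero,
      ENNReal.rpow_zero, mul_one]
    refine iSup_le fun m => ENNReal.rpow_le_rpow ?_ hr.le
    refine le_trans ?_ (h m)
    simp_rw [peak_comm ρ m]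
    exact ENNReal.sum_le_tsum _
  · have hθ' : 0 < θ.toReal := ENNReal.toReal_pos hθ hθt
    obtain ⟨C, hC, h⟩ := exists_tsum_sum_peak_rpow_le d hρ (mul_pos hr hθ')
    refine ⟨C ^ recip θ, ENNReal.rpow_ne_top_of_nonneg (by rw [recip_eq]; positivity) hC,
      fun S => ?_⟩
    simp only [ellNorm, hθt, if_false, ← recip_eq, ← ENNReal.rpow_mul]
    have h0 : 0 ≤ recip θ := by rw [recip_eq]; positivity
    rw [← ENNReal.mul_rpow_of_nonneg _ _ h0]
    exact ENNReal.rpow_le_rpow (h S) h0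

/-- Each `g i` is at most the `ℓ_q` norm of `g`, a constant that leaves the `ℓ_θ` norm. There is no
relation between `q` and `θ`. -/
theorem ellNorm_le_mul_rpow_tsum {ι : Type*} {θ : ℝ≥0∞} (hθ : θ ≠ 0) {q : ℝ} (hq : 0 < q)
    (w g : ι → ℝ≥0∞) :
    ellNorm θ (fun i => w i * g i) ≤ ellNorm θ w * (∑' i, g i ^ q) ^ (1 / q) := by
  rw [mul_comm, ← ellNorm_const_mul hθ]
  refine ellNorm_mono θ fun i => ?_
  rw [mul_comm]
  gcongr
  calc g i = (g i ^ q) ^ (1 / q) := by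
        rw [← ENNReal.rpow_mul, mul_one_div_cancel hq.ne', ENNReal.rpow_one]
    _ ≤ _ := by
      gcongr
      exact ENNReal.le_tsum i

/-! ### The one-dimensional decay estimate -/

/-- The factor `(2^min m k)⁻¹ ^ a` is an overlap count, up to `2^k`, when `a = 1`, and the `L_p`
size of the support of a single mean when `a = 1/p`. The exponent gap is `L + 1 - s` for `m ≥ k` and
`s + 1 - a` for `m < k`; the smaller one gives `ρ`. -/
theorem exists_rpow_mul_decay_le (L : ℕ) {s a : ℝ} (ha : 0 < s + 1 - a) (hs : s < L + 1) :
    ∃ ρ : ℝ, 0 < ρ ∧ ρ < 1 ∧ ∀ m k : ℕ,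
      (2 : ℝ) ^ (s * m) * LocalMeanKernels.decay L m k * ((2 : ℝ) ^ min m k)⁻¹ ^ a ≤
        2 ^ ((s - a) * k) * ρ ^ Nat.dist m k := by
  have h2 : (0 : ℝ) < 2 := two_pos
  set δ := min (L + 1 - s) (s + 1 - a) with hδ
  have hδ0 : 0 < δ := lt_min (by linarith) ha
  refine ⟨2 ^ (-δ), by positivity, Real.rpow_lt_one_of_one_lt_of_neg one_lt_two (by linarith),
    fun m k => ?_⟩
  have hpow : ∀ j : ℕ, (2 : ℝ) ^ j = 2 ^ (j : ℝ) := fun j => (Real.rpow_natCast 2 j).symm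
  rw [← Real.rpow_natCast (2 ^ (-δ)), ← Real.rpow_mul h2.le, ← Real.rpow_add h2,
    hpow, ← Real.rpow_neg h2.le, ← Real.rpow_mul h2.le]
  unfold LocalMeanKernels.decay
  split_ifs with h
  · obtain ⟨j, rfl⟩ := Nat.exists_eq_add_of_le h
    rw [Nat.dist_eq_sub_of_le_right h, min_eq_right h, hpow k, hpow (k + j),
      ← Real.rpow_sub h2, ← Real.rpow_natCast, ← Real.rpow_mul h2.le, ← Real.rpow_add h2,
      ← Real.rpow_add h2]
    refine Real.rpow_le_rpow_of_exponent_le one_le_two ?_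
    have h1 : δ * j ≤ (L + 1 - s) * j := by
      gcongr
      exact min_le_left _ _
    rw [Nat.add_sub_cancel_left]
    push_cast
    nlinarith
  · push Not at h
    obtain ⟨j, rfl⟩ := Nat.exists_eq_add_of_le h.le
    rw [Nat.dist_eq_sub_of_le h.le, min_eq_left h.le, hpow m, hpow (m + j),
      ← Real.rpow_sub h2, ← Real.rpow_add h2, ← Real.rpow_add h2]
    refine Real.rpow_le_rpow_of_exponent_le one_le_two ?_
    have h1 : δ * j ≤ (s + 1 - a) * j := by
      gcongr
      exact min_le_right _ _
    rw [Nat.add_sub_cancel_left]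
    push_cast
    nlinarith

variable {d : ℕ}

/-! ### Sums of tensor product bumps -/

/-- The tensor product bump adapted to the dyadic box `∏ i, 2^(-k i) (l i + [0,1])`. -/
noncomputable def tensorBump (k l : Fin d → ℕ) (y : Fin d → ℝ) : ℝ :=
  ∏ i, bump (2 ^ k i * y i - l i)

theorem continuous_tensorBump (k l : Fin d → ℕ) : Continuous (tensorBump k l) := by
  unfold tensorBump
  have := continuous_bump
  fun_prop

theorem tensorBump_nonneg (k l : Fin d → ℕ) (y : Fin d → ℝ) : 0 ≤ tensorBump k l y :=
  Finset.prod_nonneg fun _ _ => bump_nonneg _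

theorem tensorBump_le_one (k l : Fin d → ℕ) (y : Fin d → ℝ) : tensorBump k l y ≤ 1 :=
  Finset.prod_le_one (fun _ _ => bump_nonneg _) fun _ _ => bump_le_one _

theorem mem_Ioo_of_tensorBump_ne_zero {k l : Fin d → ℕ} {y : Fin d → ℝ}
    (h : tensorBump k l y ≠ 0) (i : Fin d) : 2 ^ k i * y i - l i ∈ Ioo (0 : ℝ) 1 :=
  bump_ne_zero_iff.1 (Finset.prod_ne_zero_iff.1 h i (Finset.mem_univ i))

/-- The indices of the dyadic boxes of scale `k` in the unit cube. -/
def boxes (k : Fin d → ℕ) : Finset (Fin d → ℕ) := Fintype.piFinset fun i => Finset.range (2 ^ k i)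

theorem mem_boxes {k l : Fin d → ℕ} : l ∈ boxes k ↔ ∀ i, l i < 2 ^ k i := by
  simp [boxes]

theorem card_boxes (k : Fin d → ℕ) : (boxes k).card = 2 ^ ∑ i, k i := by
  simp [boxes, Finset.prod_pow_eq_pow_sum]

theorem mem_unitCube_of_tensorBump_ne_zero {k l : Fin d → ℕ} (hl : l ∈ boxes k) {y : Fin d → ℝ}
    (h : tensorBump k l y ≠ 0) : y ∈ unitCube d := by
  have key : ∀ i, 0 ≤ y i ∧ y i ≤ 1 := by
    intro i
    have h1 := mem_Ioo_of_tensorBump_ne_zero h i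
    have h2 : l i + 1 ≤ 2 ^ k i := mem_boxes.1 hl i
    have h3 : (l i : ℝ) + 1 ≤ 2 ^ k i := by exact_mod_cast h2
    have h4 : (0 : ℝ) < 2 ^ k i := by positivity
    have h5 : (0 : ℝ) ≤ l i := by positivity
    constructor <;> nlinarith [h1.1, h1.2]
  exact ⟨fun i => (key i).1, fun i => (key i).2⟩

theorem integral_tensorBump (k l : Fin d → ℕ) :
    ∫ y, tensorBump k l y = ((2 : ℝ) ^ ∑ i, k i)⁻¹ * (∫ x, bump x) ^ d := by
  unfold tensorBump
  rw [integral_fintype_prod_volume_eq_prod fun i y => bump (2 ^ k i * y - l i)]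
  simp_rw [integral_bump_affine, Finset.prod_mul_distrib]
  simp [Finset.prod_pow_eq_pow_sum]

theorem integrable_tensorBump (k l : Fin d → ℕ) : Integrable (tensorBump k l) :=
  Integrable.fintype_prod (f := fun i y => bump (2 ^ k i * y - l i))
    fun i => integrable_bump_affine (k i) (l i)

/-- The function `c ∑ k ∈ S, ∑ l ∈ Λ k, tensorBump k l`. -/
noncomputable def bumpSum (c : ℝ) (S : Finset (Fin d → ℕ))
    (Λ : (Fin d → ℕ) → Finset (Fin d → ℕ)) : (Fin d → ℝ) →ᵇ ℂ :=
  BoundedContinuousFunction.ofNormedAddCommGroup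
    (fun y => ((c * ∑ k ∈ S, ∑ l ∈ Λ k, tensorBump k l y : ℝ) : ℂ))
    (by
      have := fun k l : Fin d → ℕ => continuous_tensorBump k l
      fun_prop)
    (|c| * ∑ k ∈ S, ∑ _l ∈ Λ k, 1) (fun y => by
      rw [Complex.norm_real, Real.norm_eq_abs, abs_mul]
      gcongr
      rw [abs_of_nonneg (Finset.sum_nonneg fun _ _ => Finset.sum_nonneg fun _ _ =>
        tensorBump_nonneg _ _ _)]
      gcongr
      exact tensorBump_le_one _ _ _)

variable {c : ℝ} {S : Finset (Fin d → ℕ)} {Λ : (Fin d → ℕ) → Finset (Fin d → ℕ)}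

theorem bumpSum_apply (y : Fin d → ℝ) :
    bumpSum c S Λ y = ((c * ∑ k ∈ S, ∑ l ∈ Λ k, tensorBump k l y : ℝ) : ℂ) := rfl

theorem bumpSum_eq_zero {y : Fin d → ℝ} (h : ∀ k ∈ S, ∀ l ∈ Λ k, tensorBump k l y = 0) :
    bumpSum c S Λ y = 0 := by
  rw [bumpSum_apply, Finset.sum_eq_zero fun k hk => Finset.sum_eq_zero fun l hl => h k hk l hl]
  simp

theorem bumpSum_eq_zero_of_notMem (hΛ : ∀ k ∈ S, Λ k ⊆ boxes k) {y : Fin d → ℝ}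
    (hy : y ∉ unitCube d) : bumpSum c S Λ y = 0 := by
  refine bumpSum_eq_zero fun k hk l hl => ?_
  by_contra h
  exact hy (mem_unitCube_of_tensorBump_ne_zero (hΛ k hk hl) h)

theorem dsupport_bumpSum_subset (hΛ : ∀ k ∈ S, Λ k ⊆ boxes k) :
    Distribution.dsupport (toDistribution (bumpSum c S Λ)) ⊆ unitCube d := by
  refine sInter_subset_of_mem ⟨fun φ hφ => ?_, isClosed_Icc⟩
  rw [toDistribution_apply]
  refine integral_eq_zero_of_ae (.of_forall fun y => ?_)
  by_cases hy : y ∈ unitCube d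
  · have : φ y = 0 := image_eq_zero_of_notMem_tsupport fun h => hφ h hy
    simp [this]
  · simp [bumpSum_eq_zero_of_notMem hΛ hy]

theorem setIntegral_bumpSum (hΛ : ∀ k ∈ S, Λ k ⊆ boxes k) {M N : ℕ}
    (hS : ∀ k ∈ S, ∑ i, k i = M) (hN : ∀ k ∈ S, N ≤ (Λ k).card) (hc : 0 ≤ c) :
    ENNReal.ofReal (c * S.card * N * (2 ^ M)⁻¹ * (∫ x, bump x) ^ d) ≤
      ‖∫ y in unitCube d, bumpSum c S Λ y‖ₑ := by
  rw [setIntegral_eq_integral_of_forall_compl_eq_zero fun y hy => bumpSum_eq_zero_of_notMem hΛ hy]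
  have h : ∫ y, bumpSum c S Λ y =
      ((c * ∑ k ∈ S, ∑ _l ∈ Λ k, (2 ^ M)⁻¹ * (∫ x, bump x) ^ d : ℝ) : ℂ) := by
    simp_rw [bumpSum_apply]
    rw [integral_complex_ofReal, integral_const_mul, integral_finsetSum]
    · congr 2
      refine Finset.sum_congr rfl fun k hk => ?_
      rw [integral_finsetSum _ fun l _ => integrable_tensorBump k l]
      simp_rw [integral_tensorBump, hS k hk]
    · exact fun k _ => integrable_finsetSum _ fun l _ => integrable_tensorBump k l
  rw [h, ← ofReal_norm, Complex.norm_real]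
  refine ENNReal.ofReal_le_ofReal (le_trans ?_ (le_abs_self _))
  have hI : 0 ≤ ∫ x, bump x := integral_bump_pos.le
  calc _ = c * ∑ k ∈ S, (N : ℝ) * ((2 ^ M)⁻¹ * (∫ x, bump x) ^ d) := by
        rw [Finset.sum_const, nsmul_eq_mul]; ring
    _ ≤ _ := by
      refine mul_le_mul_of_nonneg_left (Finset.sum_le_sum fun k hk => ?_) hc
      rw [Finset.sum_const, nsmul_eq_mul]
      have : (N : ℝ) ≤ (Λ k).card := by exact_mod_cast hN k hk
      gcongr

/-! ### Local means of sums of bumps -/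

namespace LocalMeanKernels

variable {L : ℕ} (K : LocalMeanKernels L)

theorem localMean_bumpSum (m : Fin d → ℕ) (x : Fin d → ℝ) :
    K.localMean m (toDistribution (bumpSum c S Λ)) x =
      c * ∑ k ∈ S, ∑ l ∈ Λ k, ∏ i, K.bumpMean (m i) (k i) (l i) (x i) := by
  rw [localMean, toDistribution_apply]
  have h : ∀ y, K.translate m x y * bumpSum c S Λ y = c * ∑ k ∈ S, ∑ l ∈ Λ k,
      ∏ i, (K.dilate (m i) (x i - y i) * (bump (2 ^ k i * y i - l i) : ℂ)) := by
    intro y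
    have e : K.translate m x y = ∏ i, K.dilate (m i) (x i - y i) := rfl
    rw [e, bumpSum_apply]
    push_cast [tensorBump]
    simp_rw [Finset.prod_mul_distrib, ← Finset.mul_sum]
    ring
  have hint : ∀ k l : Fin d → ℕ, Integrable fun y : Fin d → ℝ =>
      ∏ i, (K.dilate (m i) (x i - y i) * (bump (2 ^ k i * y i - l i) : ℂ)) := fun k l =>
    Integrable.fintype_prod
      (f := fun i y => K.dilate (m i) (x i - y) * (bump (2 ^ k i * y - l i) : ℂ))
      fun i => K.integrable_bumpMean (m i) (k i) (l i) (x i)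
  simp_rw [h]
  rw [integral_const_mul, integral_finsetSum _ fun k _ => integrable_finsetSum _ fun l _ =>
    hint k l]
  congr 1
  refine Finset.sum_congr rfl fun k _ => ?_
  rw [integral_finsetSum _ fun l _ => hint k l]
  refine Finset.sum_congr rfl fun l _ => ?_
  exact integral_fintype_prod_volume_eq_prod
    fun i y => K.dilate (m i) (x i - y) * (bump (2 ^ k i * y - l i) : ℂ)

theorem enorm_localMean_bumpSum_le (hc : 0 ≤ c) (m : Fin d → ℕ) (x : Fin d → ℝ) :
    ‖K.localMean m (toDistribution (bumpSum c S Λ)) x‖ₑ ≤ ENNReal.ofReal c *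
      ∑ k ∈ S, ∑ l ∈ Λ k, ∏ i, ‖K.bumpMean (m i) (k i) (l i) (x i)‖ₑ := by
  rw [localMean_bumpSum, enorm_mul]
  have e : ‖(c : ℂ)‖ₑ = ENNReal.ofReal c := by
    rw [← ofReal_norm, Complex.norm_real, Real.norm_of_nonneg hc]
  rw [e]
  gcongr
  refine (enorm_sum_le _ _).trans (Finset.sum_le_sum fun k _ => ?_)
  refine (enorm_sum_le _ _).trans (Finset.sum_le_sum fun l _ => ?_)
  rw [← ofReal_norm, norm_prod, ENNReal.ofReal_prod_of_nonneg fun _ _ => norm_nonneg _]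
  simp_rw [ofReal_norm]
  exact le_rfl

end LocalMeanKernels

/-! ### Tensorized decay of the weighted local means -/

theorem weight_eq_prod (s : ℝ) (m : Fin d → ℕ) :
    weight s m = ∏ i, ENNReal.ofReal (2 ^ (s * m i)) := by
  rw [weight, ← ENNReal.ofReal_prod_of_nonneg fun _ _ => by positivity,
    ← Real.rpow_sum_of_pos two_pos]
  rw [← ENNReal.ofReal_rpow_of_pos two_pos]
  simp [Finset.mul_sum]

/-- The constants produced by tensorizing `exists_rpow_mul_decay_le`. -/
theorem weight_mul_prod_le {s a C ρ : ℝ} {L : ℕ} (hC : 0 ≤ C) (hρ : 0 ≤ ρ)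
    (h : ∀ m k : ℕ, (2 : ℝ) ^ (s * m) * LocalMeanKernels.decay L m k * ((2 : ℝ) ^ min m k)⁻¹ ^ a ≤
        2 ^ ((s - a) * k) * ρ ^ Nat.dist m k) (m k : Fin d → ℕ) :
    weight s m * ∏ i, ENNReal.ofReal
        (C * (LocalMeanKernels.decay L (m i) (k i) * ((2 : ℝ) ^ min (m i) (k i))⁻¹ ^ a)) ≤
      ENNReal.ofReal (C ^ d * 2 ^ ((s - a) * ((∑ i, k i : ℕ) : ℝ))) *
        peak (ENNReal.ofReal ρ) m k := by
  have e : ENNReal.ofReal (C ^ d * 2 ^ ((s - a) * ((∑ i, k i : ℕ) : ℝ))) *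
      peak (ENNReal.ofReal ρ) m k =
      ∏ i, ENNReal.ofReal (C * (2 ^ ((s - a) * k i) * ρ ^ Nat.dist (m i) (k i))) := by
    rw [peak]
    simp_rw [← ENNReal.ofReal_pow hρ]
    rw [← ENNReal.ofReal_prod_of_nonneg fun _ _ => by positivity,
      ← ENNReal.ofReal_prod_of_nonneg fun _ _ => by positivity,
      ← ENNReal.ofReal_mul (by positivity)]
    congr 1
    simp_rw [Finset.prod_mul_distrib]
    rw [← Real.rpow_sum_of_pos two_pos]
    simp [Finset.mul_sum, mul_assoc]
  rw [e, weight_eq_prod, ← Finset.prod_mul_distrib]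
  refine Finset.prod_le_prod' fun i _ => ?_
  rw [← ENNReal.ofReal_mul (by positivity)]
  refine ENNReal.ofReal_le_ofReal ?_
  have := mul_le_mul_of_nonneg_left (h (m i) (k i)) hC
  linarith

/-! ### Quasi-norms of combinations of indicator functions -/

theorem rpow_indicator_const {α : Type*} (E : Set α) (a : ℝ≥0∞) {q : ℝ} (hq : 0 < q) (x : α) :
    (E.indicator (fun _ => a) x) ^ q = E.indicator (fun _ => a ^ q) x := by
  by_cases hx : x ∈ E <;> simp [hx, hq]

theorem mul_measure_rpow_rpow (a v : ℝ≥0∞) {q : ℝ} (hq : 0 < q) :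
    (a * v ^ (1 / q)) ^ q = a ^ q * v := by
  rw [ENNReal.mul_rpow_of_nonneg _ _ hq.le, ← ENNReal.rpow_mul, one_div_mul_cancel hq.ne',
    ENNReal.rpow_one]

theorem rpow_rpow_one_div (a : ℝ≥0∞) {q : ℝ} (hq : 0 < q) : (a ^ q) ^ (1 / q) = a := by
  rw [← ENNReal.rpow_mul, mul_one_div_cancel hq.ne', ENNReal.rpow_one]

/-- For `p ≤ 1` the `p`-th power of the quasi-norm is subadditive, so the position and overlap of
the sets play no role. -/
theorem eLpNorm_le_of_le_sum_indicator {α F ι : Type*} [MeasurableSpace α] {μ : Measure α}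
    [NormedAddCommGroup F] {p : ℝ≥0∞} (hp : p ≠ 0) (hp1 : p ≤ 1) {g : α → F} {S : Finset ι}
    {E : ι → Set α} {a : ι → ℝ≥0∞} (hE : ∀ i, MeasurableSet (E i))
    (h : ∀ x, ‖g x‖ₑ ≤ ∑ i ∈ S, (E i).indicator (fun _ => a i) x) :
    eLpNorm g p μ ≤ (∑ i ∈ S, (a i * μ (E i) ^ (1 / p.toReal)) ^ p.toReal) ^ (1 / p.toReal) := by
  have hpt : p ≠ ⊤ := ne_top_of_le_ne_top ENNReal.one_ne_top hp1
  have hP : 0 < p.toReal := ENNReal.toReal_pos hp hpt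
  have hP1 : p.toReal ≤ 1 := by simpa using ENNReal.toReal_mono ENNReal.one_ne_top hp1
  rw [eLpNorm_eq_lintegral_rpow_enorm_toReal hp hpt]
  gcongr
  calc ∫⁻ x, ‖g x‖ₑ ^ p.toReal ∂μ
      ≤ ∫⁻ x, ∑ i ∈ S, (E i).indicator (fun _ => a i ^ p.toReal) x ∂μ := by
        refine lintegral_mono fun x => ?_
        simp_rw [← rpow_indicator_const _ _ hP]
        exact (ENNReal.rpow_le_rpow (h x) hP.le).trans (rpow_sum_le_sum_rpow _ _ hP hP1)
    _ = ∑ i ∈ S, (a i * μ (E i) ^ (1 / p.toReal)) ^ p.toReal := by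
        rw [lintegral_finsetSum _ fun i _ => measurable_const.indicator (hE i)]
        refine Finset.sum_congr rfl fun i _ => ?_
        rw [lintegral_indicator_const (hE i), mul_measure_rpow_rpow _ _ hP]

/-- The inner `ℓ_θ` norm is traded for an `ℓ_p` norm, which commutes with `L_p`. The price is the
weight `w`, which must be in `ℓ_θ` for the bound to be useful. -/
theorem eLpNorm_ellNorm_indicator_le {α ι : Type*} [MeasurableSpace α] {μ : Measure α}
    [Countable ι] {p θ : ℝ≥0∞} (hp : p ≠ 0) (hpt : p ≠ ⊤) (hθ : θ ≠ 0) {w a : ι → ℝ≥0∞}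
    {E : ι → Set α} (hE : ∀ i, MeasurableSet (E i)) :
    eLpNorm (fun x => ellNorm θ fun i => w i * (E i).indicator (fun _ => a i) x) p μ ≤
      ellNorm θ w * (∑' i, (a i * μ (E i) ^ (1 / p.toReal)) ^ p.toReal) ^ (1 / p.toReal) := by
  have hP : 0 < p.toReal := ENNReal.toReal_pos hp hpt
  rw [eLpNorm_eq_lintegral_rpow_enorm_toReal hp hpt]
  calc _ ≤ (∫⁻ x, ellNorm θ w ^ p.toReal *
        ∑' i, (E i).indicator (fun _ => a i ^ p.toReal) x ∂μ) ^ (1 / p.toReal) := by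
        gcongr with x
        rw [enorm_eq_self]
        refine (ENNReal.rpow_le_rpow (ellNorm_le_mul_rpow_tsum hθ hP _ _) hP.le).trans_eq ?_
        rw [ENNReal.mul_rpow_of_nonneg _ _ hP.le, ← ENNReal.rpow_mul, one_div_mul_cancel hP.ne',
          ENNReal.rpow_one]
        simp_rw [rpow_indicator_const _ _ hP]
    _ = (ellNorm θ w ^ p.toReal *
        ∑' i, (a i * μ (E i) ^ (1 / p.toReal)) ^ p.toReal) ^ (1 / p.toReal) := by
        congr 1
        rw [lintegral_const_mul _ (Measurable.tsum fun i =>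
          measurable_const.indicator (hE i)),
          lintegral_tsum fun i => (measurable_const.indicator (hE i)).aemeasurable]
        congr 1
        refine tsum_congr fun i => ?_
        rw [lintegral_indicator_const (hE i), mul_measure_rpow_rpow _ _ hP]
    _ = _ := by
        rw [ENNReal.mul_rpow_of_nonneg _ _ (by positivity), rpow_rpow_one_div _ hP]

namespace LocalMeanKernels

variable {L : ℕ} (K : LocalMeanKernels L)

/-! ### Norm estimates for sums over many boxes -/

/-- Enlarging `Λ k` to all boxes makes the sum over `l` a product of one-dimensional sums, and all
the means live in one fixed cube. -/
theorem exists_enorm_localMean_bumpSum_le : ∃ C R : ℝ, 0 < C ∧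
    ∀ (c : ℝ) (S : Finset (Fin d → ℕ)) (Λ : (Fin d → ℕ) → Finset (Fin d → ℕ)), 0 ≤ c →
      (∀ k ∈ S, Λ k ⊆ boxes k) → ∀ (m : Fin d → ℕ) (x : Fin d → ℝ),
      ‖K.localMean m (toDistribution (bumpSum c S Λ)) x‖ₑ ≤
        (Icc (fun _ => -R) (fun _ => R + 1)).indicator (fun _ => ENNReal.ofReal c *
          ∑ k ∈ S, ∏ i, ENNReal.ofReal
            (C * (decay L (m i) (k i) * (2 ^ k i / 2 ^ min (m i) (k i))))) x := by
  obtain ⟨C, hC, hsum⟩ := K.exists_sum_norm_bumpMean_le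
  obtain ⟨R, hR, hsupp⟩ := K.exists_abs_sub_le_of_bumpMean_ne_zero
  refine ⟨C, R, hC, fun c S Λ hc hΛ m x => (enorm_localMean_bumpSum_le K hc m x).trans ?_⟩
  by_cases hx : x ∈ Icc (fun _ : Fin d => -R) (fun _ => R + 1)
  · rw [indicator_of_mem hx]
    gcongr with k hk
    calc _ ≤ ∑ l ∈ boxes k, ∏ i, ‖K.bumpMean (m i) (k i) (l i) (x i)‖ₑ :=
          Finset.sum_le_sum_of_subset (hΛ k hk)
      _ = ∏ i, ∑ l ∈ Finset.range (2 ^ k i), ‖K.bumpMean (m i) (k i) l (x i)‖ₑ :=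
          (Finset.prod_univ_sum (fun i => Finset.range (2 ^ k i))
            fun i l => ‖K.bumpMean (m i) (k i) l (x i)‖ₑ).symm
      _ ≤ _ := by
          refine Finset.prod_le_prod' fun i _ => ?_
          simp_rw [← ofReal_norm]
          rw [← ENNReal.ofReal_sum_of_nonneg fun _ _ => norm_nonneg _]
          exact ENNReal.ofReal_le_ofReal (hsum _ _ _ _)
  · rw [indicator_of_notMem hx, nonpos_iff_eq_zero]
    refine mul_eq_zero_of_right _ (Finset.sum_eq_zero fun k hk => Finset.sum_eq_zero fun l hl => ?_)
    by_contra hne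
    refine hx ?_
    have key : ∀ i, -R ≤ x i ∧ x i ≤ R + 1 := by
      intro i
      have h1 := hsupp (m i) (k i) (l i) (x i)
        (by simpa using Finset.prod_ne_zero_iff.1 hne i (Finset.mem_univ i))
      have h2 : R / 2 ^ min (m i) (k i) ≤ R :=
        div_le_self (by linarith) (one_le_pow₀ one_le_two)
      have h3 : (l i : ℝ) / 2 ^ k i ≤ 1 := by
        rw [div_le_one (by positivity)]
        exact_mod_cast (mem_boxes.1 (hΛ k hk hl) i).le
      have h4 : (0 : ℝ) ≤ (l i : ℝ) / 2 ^ k i := by positivity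
      have h5 := abs_le.1 (h1.trans h2)
      constructor <;> linarith
    exact ⟨fun i => (key i).1, fun i => (key i).2⟩

/-- Every local mean is dominated by a constant on a fixed cube, so both norms reduce to the same
`ℓ_θ` norm, and `p` enters only through the volume of that cube. -/
theorem exists_norm_bumpSum_le {s : ℝ} (hs0 : 0 < s) (hs : s < L + 1) (p : ℝ≥0∞) {θ : ℝ≥0∞}
    (hθ : θ ≠ 0) : ∃ C : ℝ≥0∞, C ≠ ⊤ ∧
    ∀ (c : ℝ) (S : Finset (Fin d → ℕ)) (Λ : (Fin d → ℕ) → Finset (Fin d → ℕ)) (M : ℕ), 0 ≤ c →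
      (∀ k ∈ S, Λ k ⊆ boxes k) → (∀ k ∈ S, ∑ i, k i = M) →
      besovNorm K s p θ (toDistribution (bumpSum c S Λ)) ≤
        C * (ENNReal.ofReal (c * 2 ^ (s * M)) * (S.card : ℝ≥0∞) ^ recip θ) ∧
      triebelLizorkinNorm K s p θ (toDistribution (bumpSum c S Λ)) ≤
        C * (ENNReal.ofReal (c * 2 ^ (s * M)) * (S.card : ℝ≥0∞) ^ recip θ) := by
  obtain ⟨C, R, hC, hpt⟩ := K.exists_enorm_localMean_bumpSum_le (d := d)
  -- The overlap count `2^k / 2^min m k` is `2^k` times the factor with `a = 1`; the factors `2^k`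
  -- multiply to `2^M` and restore `2^(sM)` from `2^((s-1)M)`.
  obtain ⟨ρ, hρ0, hρ1, hρ⟩ := exists_rpow_mul_decay_le L (s := s) (a := 1) (by linarith) hs
  obtain ⟨W, hW, hsum⟩ := exists_ellNorm_sum_peak_rpow_le d (ρ := ENNReal.ofReal ρ)
    (by simpa using hρ1) one_pos hθ
  set E : Set (Fin d → ℝ) := Icc (fun _ => -R) (fun _ => R + 1) with hE
  set V : ℝ≥0∞ := volume E ^ (1 / p.toReal) with hV
  have hVt : V ≠ ⊤ := ENNReal.rpow_ne_top_of_nonneg (by positivity)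
    (isCompact_Icc.measure_lt_top).ne
  refine ⟨V * (ENNReal.ofReal (C ^ d) * W), ENNReal.mul_ne_top hVt
    (ENNReal.mul_ne_top ENNReal.ofReal_ne_top hW), fun c S Λ M hc hΛ hS => ?_⟩
  set A : (Fin d → ℕ) → ℝ≥0∞ := fun m => ENNReal.ofReal c * ∑ k ∈ S, ∏ i, ENNReal.ofReal
    (C * (decay L (m i) (k i) * (2 ^ k i / 2 ^ min (m i) (k i)))) with hA
  have hpt' := hpt c S Λ hc hΛ
  have hWA : ∀ m, weight s m * A m ≤ (ENNReal.ofReal (C ^ d) * ENNReal.ofReal (c * 2 ^ (s * M))) *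
      (∑ k ∈ S, peak (ENNReal.ofReal ρ) m k) ^ (1 : ℝ) := by
    intro m
    rw [ENNReal.rpow_one, hA, mul_left_comm, Finset.mul_sum, Finset.mul_sum, Finset.mul_sum]
    refine Finset.sum_le_sum fun k hk => ?_
    have h1 := weight_mul_prod_le hC.le hρ0.le hρ m k
    rw [hS k hk] at h1
    have e1 : ∏ i, ENNReal.ofReal (C * (decay L (m i) (k i) * (2 ^ k i / 2 ^ min (m i) (k i)))) =
        ENNReal.ofReal (2 ^ M) * ∏ i, ENNReal.ofReal
          (C * (decay L (m i) (k i) * ((2 : ℝ) ^ min (m i) (k i))⁻¹ ^ (1 : ℝ))) := by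
      have hd := fun i => (decay_pos L (m i) (k i)).le
      rw [← ENNReal.ofReal_prod_of_nonneg fun i _ => by have := hd i; positivity,
        ← ENNReal.ofReal_prod_of_nonneg fun i _ => by have := hd i; positivity,
        ← ENNReal.ofReal_mul (by positivity), ← hS k hk, ← Finset.prod_pow_eq_pow_sum,
        ← Finset.prod_mul_distrib]
      congr 1
      refine Finset.prod_congr rfl fun i _ => ?_
      rw [Real.rpow_one]
      ring
    rw [e1, mul_left_comm (weight s m)]
    calc _ ≤ ENNReal.ofReal c * (ENNReal.ofReal (2 ^ M) *
          (ENNReal.ofReal (C ^ d * 2 ^ ((s - 1) * M)) * peak (ENNReal.ofReal ρ) m k)) := by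
          gcongr
      _ = _ := by
        rw [← mul_assoc, ← mul_assoc, ← ENNReal.ofReal_mul hc,
          ← ENNReal.ofReal_mul (by positivity), ← ENNReal.ofReal_mul (by positivity)]
        congr 2
        have : (2 : ℝ) ^ (s * M) = 2 ^ ((s - 1) * M) * 2 ^ M := by
          rw [← Real.rpow_natCast 2 M, ← Real.rpow_add two_pos]
          ring_nf
        rw [this]
        ring
  have hfin : V * ellNorm θ (fun m => weight s m * A m) ≤ V * (ENNReal.ofReal (C ^ d) * W) *
      (ENNReal.ofReal (c * 2 ^ (s * M)) * (S.card : ℝ≥0∞) ^ recip θ) := by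
    calc _ ≤ V * ((ENNReal.ofReal (C ^ d) * ENNReal.ofReal (c * 2 ^ (s * M))) *
          (W * (S.card : ℝ≥0∞) ^ recip θ)) := by
          gcongr
          refine (ellNorm_mono θ hWA).trans ?_
          rw [ellNorm_const_mul hθ]
          gcongr
          exact hsum S
      _ = _ := by ring
  constructor
  · refine le_trans ?_ hfin
    rw [besovNorm, ← ellNorm_const_mul hθ]
    refine ellNorm_mono θ fun m => ?_
    rw [mul_left_comm, mul_comm V]
    gcongr
    calc _ ≤ eLpNorm (E.indicator fun _ => A m) p volume :=
          eLpNorm_mono_enorm fun x => by simpa using hpt' m x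
      _ ≤ _ := (eLpNorm_indicator_const_le (A m) p).trans_eq (by rw [enorm_eq_self])
  · refine le_trans ?_ hfin
    rw [triebelLizorkinNorm]
    calc _ ≤ eLpNorm (E.indicator fun _ => ellNorm θ fun m => weight s m * A m) p volume := by
          refine eLpNorm_mono_enorm fun x => ?_
          rw [enorm_eq_self, enorm_eq_self]
          by_cases hx : x ∈ E
          · rw [indicator_of_mem hx]
            refine ellNorm_mono θ fun m => ?_
            gcongr
            simpa [hx] using hpt' m x
          · rw [indicator_of_notMem hx, nonpos_iff_eq_zero, ← ellNorm_zero (ι := Fin d → ℕ) hθ]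
            congr 1
            ext m
            have := hpt' m x
            rw [indicator_of_notMem hx, nonpos_iff_eq_zero] at this
            rw [this, mul_zero]
      _ ≤ _ := by
          rw [mul_comm]
          exact (eLpNorm_indicator_const_le (ellNorm θ fun m => weight s m * A m) p).trans_eq
            (by rw [enorm_eq_self])

/-! ### Norm estimates for single boxes -/

/-- The region seen by the local mean of scale `m` of the bump `tensorBump k l`. -/
def region (R : ℝ) (m k l : Fin d → ℕ) : Set (Fin d → ℝ) :=
  univ.pi fun i => Metric.closedBall ((l i : ℝ) / 2 ^ k i) (R / 2 ^ min (m i) (k i))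

theorem measurableSet_region (R : ℝ) (m k l : Fin d → ℕ) : MeasurableSet (region R m k l) :=
  MeasurableSet.univ_pi fun _ => measurableSet_closedBall

theorem prod_mul_volume_region {C R : ℝ} (hC : 0 ≤ C) (hR : 0 ≤ R) {a : ℝ} (ha : 0 ≤ a)
    (m k l : Fin d → ℕ) :
    (∏ i, ENNReal.ofReal (C * decay L (m i) (k i))) * volume (region R m k l) ^ a =
      ∏ i, ENNReal.ofReal (C * (2 * R) ^ a *
        (decay L (m i) (k i) * ((2 : ℝ) ^ min (m i) (k i))⁻¹ ^ a)) := by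
  rw [region, volume_pi_pi, ← ENNReal.prod_rpow_of_nonneg ha, ← Finset.prod_mul_distrib]
  refine Finset.prod_congr rfl fun i _ => ?_
  have hd := (decay_pos L (m i) (k i)).le
  rw [Real.volume_closedBall, ENNReal.ofReal_rpow_of_nonneg (by positivity) ha,
    ← ENNReal.ofReal_mul (by positivity)]
  congr 1
  rw [div_eq_mul_inv, ← mul_assoc, Real.mul_rpow (by positivity) (by positivity)]
  ring

theorem exists_prod_enorm_bumpMean_le : ∃ C R : ℝ, 0 < C ∧ 0 < R ∧
    ∀ (m k l : Fin d → ℕ) (x : Fin d → ℝ), ∏ i, ‖K.bumpMean (m i) (k i) (l i) (x i)‖ₑ ≤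
      (region R m k l).indicator (fun _ => ∏ i, ENNReal.ofReal (C * decay L (m i) (k i))) x := by
  obtain ⟨C, hC, hle⟩ := K.exists_norm_bumpMean_le
  obtain ⟨R, hR, hsupp⟩ := K.exists_abs_sub_le_of_bumpMean_ne_zero
  refine ⟨C, R, hC, by linarith, fun m k l x => ?_⟩
  by_cases hx : x ∈ region R m k l
  · rw [indicator_of_mem hx]
    refine Finset.prod_le_prod' fun i _ => ?_
    rw [← ofReal_norm]
    exact ENNReal.ofReal_le_ofReal (hle _ _ _ _)
  · rw [indicator_of_notMem hx, nonpos_iff_eq_zero]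
    by_contra hne
    refine hx fun i _ => ?_
    rw [Metric.mem_closedBall, Real.dist_eq]
    exact hsupp _ _ _ _ (by simpa using Finset.prod_ne_zero_iff.1 hne i (Finset.mem_univ i))

/-- For `p ≤ 1` the `p`-th powers of the contributions of the scales add, each with ratio `ρ^p` in
`|m-k|`; the outer root `1/p` is the exponent `r` in `exists_ellNorm_sum_peak_rpow_le`. -/
theorem exists_besovNorm_bumpSum_singleton_le {s : ℝ} (hs : s < L + 1) {p θ : ℝ≥0∞} (hp : p ≠ 0)
    (hp1 : p ≤ 1) (hsp : recip p - 1 < s) (hθ : θ ≠ 0) : ∃ C : ℝ≥0∞, C ≠ ⊤ ∧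
    ∀ (c : ℝ) (S : Finset (Fin d → ℕ)) (l : (Fin d → ℕ) → Fin d → ℕ) (M : ℕ), 0 ≤ c →
      (∀ k ∈ S, ∑ i, k i = M) →
      besovNorm K s p θ (toDistribution (bumpSum c S fun k => {l k})) ≤
        C * (ENNReal.ofReal (c * 2 ^ ((s - recip p) * M)) * (S.card : ℝ≥0∞) ^ recip θ) := by
  have hP : 0 < p.toReal :=
    ENNReal.toReal_pos hp (ne_top_of_le_ne_top ENNReal.one_ne_top hp1)
  have ha : 0 ≤ recip p := by rw [recip_eq]; positivity
  obtain ⟨C, R, hC, hR, hpt⟩ := K.exists_prod_enorm_bumpMean_le (d := d)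
  obtain ⟨ρ, hρ0, hρ1, hρ⟩ := exists_rpow_mul_decay_le L (s := s) (a := recip p)
    (by linarith) hs
  obtain ⟨W, hW, hsum⟩ := exists_ellNorm_sum_peak_rpow_le d (ρ := ENNReal.ofReal ρ ^ p.toReal)
    (ENNReal.rpow_lt_one (by simpa using hρ1) hP) (r := 1 / p.toReal) (by positivity) hθ
  set B := C * (2 * R) ^ recip p with hB
  refine ⟨ENNReal.ofReal (B ^ d) * W, ENNReal.mul_ne_top ENNReal.ofReal_ne_top hW,
    fun c S l M hc hS => ?_⟩
  have key : ∀ m, weight s m *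
      eLpNorm (K.localMean m (toDistribution (bumpSum c S fun k => {l k}))) p volume ≤
      ENNReal.ofReal (B ^ d) * ENNReal.ofReal (c * 2 ^ ((s - recip p) * M)) *
        (∑ k ∈ S, peak (ENNReal.ofReal ρ ^ p.toReal) m k) ^ (1 / p.toReal) := by
    intro m
    have h1 := eLpNorm_le_of_le_sum_indicator (μ := volume) hp hp1
      (g := K.localMean m (toDistribution (bumpSum c S fun k => {l k}))) (S := S)
      (E := fun k => region R m k (l k))
      (a := fun k => ENNReal.ofReal c * ∏ i, ENNReal.ofReal (C * decay L (m i) (k i)))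
      (fun k => measurableSet_region R m k (l k)) (fun x => by
        refine (enorm_localMean_bumpSum_le K hc m x).trans ?_
        rw [Finset.mul_sum]
        refine Finset.sum_le_sum fun k _ => ?_
        rw [Finset.sum_singleton, indicator_const_mul]
        gcongr
        exact hpt m k (l k) x)
    calc _ ≤ weight s m * _ := mul_le_mul_right h1 _
      _ = (∑ k ∈ S, (weight s m * (ENNReal.ofReal c *
          (∏ i, ENNReal.ofReal (C * decay L (m i) (k i))) *
          volume (region R m k (l k)) ^ (1 / p.toReal))) ^ p.toReal) ^ (1 / p.toReal) := by
        simp_rw [ENNReal.mul_rpow_of_nonneg (weight s m) _ hP.le]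
        rw [← Finset.mul_sum, ENNReal.mul_rpow_of_nonneg _ _ (by positivity),
          rpow_rpow_one_div _ hP]
      _ ≤ (∑ k ∈ S, (ENNReal.ofReal (B ^ d) * ENNReal.ofReal (c * 2 ^ ((s - recip p) * M)) *
          peak (ENNReal.ofReal ρ) m k) ^ p.toReal) ^ (1 / p.toReal) := by
        refine ENNReal.rpow_le_rpow (Finset.sum_le_sum fun k hk =>
          ENNReal.rpow_le_rpow ?_ hP.le) (by positivity)
        rw [← recip_eq, mul_assoc, prod_mul_volume_region hC.le hR.le ha, mul_left_comm]
        refine (mul_le_mul_right (weight_mul_prod_le (by positivity) hρ0.le hρ m k) _).trans_eq ?_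
        rw [hS k hk, ← mul_assoc, ← ENNReal.ofReal_mul hc, ← ENNReal.ofReal_mul (by positivity),
          mul_left_comm]
      _ = _ := by
        simp_rw [ENNReal.mul_rpow_of_nonneg (_ * _) _ hP.le, peak_rpow _ _ _ hP.le]
        rw [← Finset.mul_sum, ENNReal.mul_rpow_of_nonneg _ _ (by positivity),
          rpow_rpow_one_div _ hP]
  rw [besovNorm]
  refine (ellNorm_mono θ key).trans ?_
  rw [ellNorm_const_mul hθ]
  refine (mul_le_mul_right (hsum S) _).trans_eq ?_
  ring

theorem exists_triebelLizorkinNorm_bumpSum_singleton_le {s : ℝ} (hs : s < L + 1) {p θ : ℝ≥0∞}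
    (hp : p ≠ 0) (hpt : p ≠ ⊤) (hsp : recip p - 1 < s) (hθ : θ ≠ 0) : ∃ C : ℝ≥0∞, C ≠ ⊤ ∧
    ∀ (c : ℝ) (k l : Fin d → ℕ), 0 ≤ c →
      triebelLizorkinNorm K s p θ (toDistribution (bumpSum c {k} fun _ => {l})) ≤
        C * ENNReal.ofReal (c * 2 ^ ((s - recip p) * (∑ i, k i : ℕ))) := by
  have hP : 0 < p.toReal := ENNReal.toReal_pos hp hpt
  have ha : 0 ≤ recip p := by rw [recip_eq]; positivity
  obtain ⟨C, R, hC, hR, hle⟩ := K.exists_prod_enorm_bumpMean_le (d := d)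
  obtain ⟨ρ, hρ0, hρ1, hρ⟩ := exists_rpow_mul_decay_le L (s := s) (a := recip p)
    (by linarith) hs
  -- The decay `ρ = τ²` is shared: one factor `τ` makes the weight `ℓ_θ`-summable, the other keeps
  -- the remaining `ℓ_p` sum finite.
  set τ := ENNReal.ofReal √ρ with hτ
  have hτ1 : τ < 1 := by
    rw [hτ, ENNReal.ofReal_lt_one]
    simpa [Real.sqrt_lt' one_pos] using hρ1
  have hτ0 : τ ≠ 0 := by simpa [hτ] using hρ0
  have hττ : ENNReal.ofReal ρ = τ * τ := by
    rw [hτ, ← ENNReal.ofReal_mul (by positivity), Real.mul_self_sqrt hρ0.le]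
  obtain ⟨W₁, hW₁, h₁⟩ := exists_ellNorm_sum_peak_rpow_le d hτ1 one_pos hθ
  obtain ⟨W₂, hW₂, h₂⟩ := exists_tsum_peak_le d (ρ := τ ^ p.toReal) (ENNReal.rpow_lt_one hτ1 hP)
  set B := C * (2 * R) ^ recip p with hB
  refine ⟨W₁ * (ENNReal.ofReal (B ^ d) * W₂ ^ (1 / p.toReal)), ENNReal.mul_ne_top hW₁
    (ENNReal.mul_ne_top ENNReal.ofReal_ne_top (ENNReal.rpow_ne_top_of_nonneg (by positivity) hW₂)),
    fun c k l hc => ?_⟩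
  set D : (Fin d → ℕ) → ℝ≥0∞ := fun m => ENNReal.ofReal c *
    (weight s m * ∏ i, ENNReal.ofReal (C * decay L (m i) (k i))) with hD
  have hw0 : ∀ m, peak τ m k ≠ 0 := fun m => peak_ne_zero hτ0 m k
  have hwt : ∀ m, peak τ m k ≠ ⊤ := fun m => peak_ne_top (hτ1.trans_le le_top).ne m k
  have hell : ellNorm θ (fun m => peak τ m k) ≤ W₁ := by
    simpa using h₁ {k}
  calc _ ≤ eLpNorm (fun x => ellNorm θ fun m => peak τ m k *
        (region R m k l).indicator (fun _ => D m / peak τ m k) x) p volume := by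
        refine eLpNorm_mono_enorm fun x => ?_
        rw [enorm_eq_self, enorm_eq_self]
        refine ellNorm_mono θ fun m => ?_
        rw [← indicator_const_mul, ENNReal.mul_div_cancel (hw0 m) (hwt m)]
        have h3 := enorm_localMean_bumpSum_le (S := {k}) (Λ := fun _ => {l}) K hc m x
        rw [Finset.sum_singleton, Finset.sum_singleton] at h3
        rw [indicator_const_mul, indicator_const_mul, mul_left_comm]
        gcongr
        exact h3.trans (mul_le_mul_right (hle m k l x) _)
    _ ≤ _ := eLpNorm_ellNorm_indicator_le hp hpt hθ fun m => measurableSet_region R m k l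
    _ ≤ W₁ * (∑' m, (ENNReal.ofReal (B ^ d) *
          ENNReal.ofReal (c * 2 ^ ((s - recip p) * (∑ i, k i : ℕ))) *
          peak τ m k) ^ p.toReal) ^ (1 / p.toReal) := by
        refine mul_le_mul' hell (ENNReal.rpow_le_rpow (ENNReal.tsum_le_tsum fun m =>
          ENNReal.rpow_le_rpow ?_ hP.le) (by positivity))
        rw [div_eq_mul_inv, mul_right_comm, ← div_eq_mul_inv]
        refine ENNReal.div_le_of_le_mul ?_
        rw [← recip_eq, hD, mul_assoc, mul_assoc (weight s m),
          prod_mul_volume_region hC.le hR.le ha]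
        refine (mul_le_mul_right (weight_mul_prod_le (by positivity) hρ0.le hρ m k) _).trans_eq ?_
        rw [← mul_assoc, ← ENNReal.ofReal_mul hc, ← ENNReal.ofReal_mul (by positivity),
          mul_left_comm, hττ, ← peak_mul, mul_assoc]
    _ ≤ _ := by
        simp_rw [ENNReal.mul_rpow_of_nonneg (_ * _) _ hP.le, peak_rpow _ _ _ hP.le]
        rw [ENNReal.tsum_mul_left, ENNReal.mul_rpow_of_nonneg _ _ (by positivity),
          rpow_rpow_one_div _ hP]
        calc _ ≤ W₁ * (ENNReal.ofReal (B ^ d) *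
            ENNReal.ofReal (c * 2 ^ ((s - recip p) * (∑ i, k i : ℕ))) * W₂ ^ (1 / p.toReal)) := by
              gcongr
              exact h₂ k
          _ = _ := by ring

end LocalMeanKernels

/-! ### Boxes without nodes -/

open Classical in
/-- The dyadic boxes of scale `k` whose bump vanishes at all the nodes. -/
noncomputable def emptyBoxes {n : ℕ} (x : Fin n → unitCube d) (k : Fin d → ℕ) :
    Finset (Fin d → ℕ) :=
  {l ∈ boxes k | ∀ i, tensorBump k l (x i) = 0}

theorem emptyBoxes_subset {n : ℕ} (x : Fin n → unitCube d) (k : Fin d → ℕ) :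
    emptyBoxes x k ⊆ boxes k :=
  Finset.filter_subset _ _

theorem tensorBump_eq_zero_of_mem_emptyBoxes {n : ℕ} {x : Fin n → unitCube d} {k l : Fin d → ℕ}
    (h : l ∈ emptyBoxes x k) (i : Fin n) : tensorBump k l (x i) = 0 :=
  (Finset.mem_filter.1 h).2 i

/-- A bump that is nonzero at a node has its index determined by the node, as the coordinatewise
floor of `2^(k j) x j`; so at most `n` boxes are lost. -/
theorem two_pow_le_card_emptyBoxes_add {n : ℕ} (x : Fin n → unitCube d) (k : Fin d → ℕ) :
    2 ^ ∑ i, k i ≤ (emptyBoxes x k).card + n := by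
  classical
  rw [← card_boxes, emptyBoxes,
    ← Finset.card_filter_add_card_filter_not (s := boxes k) fun l => ∀ i, tensorBump k l (x i) = 0]
  gcongr
  calc _ ≤ (Finset.univ.image fun (i : Fin n) (j : Fin d) =>
        ⌊2 ^ k j * (x i : Fin d → ℝ) j⌋₊).card := by
        refine Finset.card_le_card fun l hl => ?_
        obtain ⟨i, hi⟩ := not_forall.1 (Finset.mem_filter.1 hl).2
        refine Finset.mem_image.2 ⟨i, Finset.mem_univ _, funext fun j => ?_⟩
        have h := mem_Ioo_of_tensorBump_ne_zero hi j
        have hl0 : (0 : ℝ) ≤ l j := by positivity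
        rw [Nat.floor_eq_iff (by linarith [h.1])]
        constructor <;> linarith [h.1, h.2]
    _ ≤ n := by simpa using Finset.card_image_le (s := (Finset.univ : Finset (Fin n)))

/-! ### Many scales of the same order -/

/-- Let all coordinates but the first range freely over `0, …, ⌊M/d⌋`. Their sum is at most `M`, so
the first coordinate can be set to complete the total. -/
theorem exists_scales (hd : 1 ≤ d) (M : ℕ) : ∃ S : Finset (Fin d → ℕ),
    (∀ k ∈ S, ∑ i, k i = M) ∧ ((M : ℝ) / d) ^ (d - 1) ≤ S.card := by
  obtain ⟨e, rfl⟩ : ∃ e, d = e + 1 := ⟨d - 1, by omega⟩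
  set T : Finset (Fin e → ℕ) := Fintype.piFinset fun _ => Finset.range (M / (e + 1) + 1) with hT
  have hinj : Function.Injective fun j : Fin e → ℕ =>
      (Fin.cons (M - ∑ i, j i) j : Fin (e + 1) → ℕ) := fun j j' h => by
    simpa using (congrArg Fin.tail h)
  refine ⟨T.image fun j => Fin.cons (M - ∑ i, j i) j, fun k hk => ?_, ?_⟩
  · obtain ⟨j, hj, rfl⟩ := Finset.mem_image.1 hk
    rw [Fin.sum_cons]
    refine Nat.sub_add_cancel ?_
    calc ∑ i, j i ≤ ∑ _i : Fin e, M / (e + 1) := by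
          refine Finset.sum_le_sum fun i _ => ?_
          have := Fintype.mem_piFinset.1 hj i
          rw [Finset.mem_range] at this
          omega
      _ = e * (M / (e + 1)) := by simp
      _ ≤ (e + 1) * (M / (e + 1)) := by gcongr; omega
      _ ≤ M := Nat.mul_div_le _ _
  · rw [Finset.card_image_of_injective _ hinj, hT]
    simp only [Fintype.card_piFinset, Finset.card_range, Finset.prod_const, Finset.card_univ,
      Fintype.card_fin, Nat.add_sub_cancel]
    push_cast
    gcongr
    have h := (Nat.lt_floor_add_one ((M : ℝ) / ((e + 1 : ℕ) : ℝ))).le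
    rw [Nat.floor_div_eq_div] at h
    exact_mod_cast h

/-- Used with `r = 1/θ`. If `r ≤ 1` many scales help; if `r ≥ 1` more scales do not help, and one is
taken. -/
theorem exists_scales_rpow (hd : 1 ≤ d) {r : ℝ} : ∃ c : ℝ, 0 < c ∧ ∀ M : ℕ, 1 ≤ M →
    ∃ S : Finset (Fin d → ℕ), S.Nonempty ∧ (∀ k ∈ S, ∑ i, k i = M) ∧
      c * (M : ℝ) ^ (((d : ℝ) - 1) * max (1 - r) 0) ≤ (S.card : ℝ) ^ (1 - r) := by
  have hd0 : (0 : ℝ) < d := by exact_mod_cast hd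
  rcases le_total r 1 with hr | hr
  · refine ⟨((d : ℝ)⁻¹ ^ (d - 1)) ^ (1 - r), by positivity, fun M hM => ?_⟩
    obtain ⟨S, hS, hcard⟩ := exists_scales hd M
    have hM0 : (0 : ℝ) < M := by exact_mod_cast hM
    have hS0 : (0 : ℝ) < S.card := lt_of_lt_of_le (by positivity) hcard
    refine ⟨S, Finset.card_pos.1 (by exact_mod_cast hS0), hS, ?_⟩
    rw [max_eq_left (by linarith), Real.rpow_mul hM0.le,
      ← Real.mul_rpow (by positivity) (by positivity)]
    refine Real.rpow_le_rpow (by positivity) (le_of_eq_of_le ?_ hcard) (by linarith)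
    have : ((d : ℝ) - 1) = ((d - 1 : ℕ) : ℝ) := by push_cast [hd]; ring
    rw [this, Real.rpow_natCast, div_eq_inv_mul, mul_pow]
  · refine ⟨1, one_pos, fun M _ => ⟨{Pi.single ⟨0, hd⟩ M}, by simp, by simp, ?_⟩⟩
    rw [max_eq_right (by linarith)]
    simp

/-! ### Lower bounds for the optimal error -/

/-- A function vanishing at all nodes is integrated to `0` by every choice of weights. Here `G` is
the growth of the norm and `b` the resulting ratio of integral to norm, up to constants. -/
theorem le_optimalError {A : Set 𝓢'(Fin d → ℝ, ℂ)} {nrm : 𝓢'(Fin d → ℝ, ℂ) → ℝ≥0∞}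
    (hA : ∀ f, nrm f < ⊤ → f ∈ A) {n : ℕ} {b : ℝ} {C : ℝ≥0∞} (hC : C ≠ ⊤)
    (h : ∀ x : Fin n → unitCube d, ∃ (S : Finset (Fin d → ℕ))
      (Λ : (Fin d → ℕ) → Finset (Fin d → ℕ)) (M N : ℕ) (G : ℝ),
      (∀ k ∈ S, Λ k ⊆ emptyBoxes x k) ∧ (∀ k ∈ S, ∑ i, k i = M) ∧ (∀ k ∈ S, N ≤ (Λ k).card) ∧
      0 < G ∧ (∀ c, 0 ≤ c → nrm (toDistribution (bumpSum c S Λ)) ≤ C * ENNReal.ofReal (c * G)) ∧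
      b * G ≤ S.card * (N * (2 ^ M)⁻¹)) :
    ENNReal.ofReal ((∫ x, bump x) ^ d / (C.toReal + 1) * b) ≤
      optimalError (continuousPart (supportedInCube A)) (fun f => nrm (toDistribution f)) n := by
  refine le_iInf fun x => le_iInf fun w => ?_
  obtain ⟨S, Λ, M, N, G, hΛ, hS, hN, hG, hnrm, hb⟩ := h x
  have hI := integral_bump_pos
  have hC0 : 0 ≤ C.toReal := ENNReal.toReal_nonneg
  -- The scaling that puts the function in the unit ball; `+ 1` covers `C = 0`.
  set c : ℝ := ((C.toReal + 1) * G)⁻¹ with hc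
  have hc0 : 0 ≤ c := by positivity
  have hle : nrm (toDistribution (bumpSum c S Λ)) ≤ 1 := by
    refine (hnrm c hc0).trans ?_
    rw [← ENNReal.ofReal_toReal hC, ← ENNReal.ofReal_mul hC0, ENNReal.ofReal_le_one, hc,
      mul_inv, inv_mul_cancel_right₀ hG.ne', ← div_eq_mul_inv, div_le_one (by positivity)]
    linarith
  have hΛ' : ∀ k ∈ S, Λ k ⊆ boxes k := fun k hk => (hΛ k hk).trans (emptyBoxes_subset x k)
  refine le_iSup₂_of_le (bumpSum c S Λ)
    ⟨⟨hA _ (hle.trans_lt ENNReal.one_lt_top), dsupport_bumpSum_subset hΛ'⟩, hle⟩ ?_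
  have hzero : ∑ i, (w i : ℂ) * bumpSum c S Λ (x i : Fin d → ℝ) = 0 :=
    Finset.sum_eq_zero fun i _ => by
      rw [bumpSum_eq_zero fun k hk l hl => tensorBump_eq_zero_of_mem_emptyBoxes (hΛ k hk hl) i,
        mul_zero]
  rw [hzero, sub_zero]
  refine le_trans (ENNReal.ofReal_le_ofReal ?_) (setIntegral_bumpSum hΛ' hS hN hc0)
  have e : (∫ x, bump x) ^ d / (C.toReal + 1) * b = c * (b * G) * (∫ x, bump x) ^ d := by
    rw [hc]
    field_simp
  rw [e]
  calc _ ≤ c * (S.card * (N * (2 ^ M)⁻¹)) * (∫ x, bump x) ^ d := by gcongr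
    _ = _ := by ring

/-- The order `log₂ n + 2` of the dyadic boxes used to fool `n` nodes. -/
def order (n : ℕ) : ℕ := Nat.log 2 n + 2

theorem two_mul_lt_two_pow_order (n : ℕ) : 2 * n < 2 ^ order n := by
  have h := Nat.lt_pow_succ_log_self one_lt_two n
  rw [order, show Nat.log 2 n + 2 = (Nat.log 2 n).succ + 1 from rfl, pow_succ]
  omega

theorem two_pow_order_le {n : ℕ} (hn : 1 ≤ n) : 2 ^ order n ≤ 4 * n := by
  have h := Nat.pow_log_le_self 2 (x := n) (by omega)
  rw [order, pow_add]
  omega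

theorem log_le_order {n : ℕ} (hn : 1 ≤ n) : Real.log n ≤ order n := by
  have hn0 : (0 : ℝ) < n := by exact_mod_cast hn
  have h : (n : ℝ) ≤ 2 ^ order n := by
    have := two_mul_lt_two_pow_order n
    exact_mod_cast (by omega : n ≤ 2 ^ order n)
  calc Real.log n ≤ Real.log (2 ^ order n) := Real.log_le_log hn0 h
    _ = order n * Real.log 2 := Real.log_pow _ _
    _ ≤ order n * 1 := by
      gcongr
      linarith [Real.log_two_lt_d9]
    _ = _ := mul_one _

theorem rpow_neg_mul_two_rpow_order_le {n : ℕ} (hn : 1 ≤ n) {u : ℝ} (hu : 0 ≤ u) :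
    (n : ℝ) ^ (-u) * 2 ^ (u * order n) ≤ 4 ^ u := by
  have hn0 : (0 : ℝ) < n := by exact_mod_cast hn
  have h : (2 : ℝ) ^ order n ≤ 4 * n := by exact_mod_cast two_pow_order_le hn
  calc (n : ℝ) ^ (-u) * 2 ^ (u * order n) = (n : ℝ) ^ (-u) * (2 ^ order n) ^ u := by
        rw [mul_comm u, Real.rpow_mul two_pos.le, Real.rpow_natCast]
    _ ≤ (n : ℝ) ^ (-u) * (4 * n) ^ u := by gcongr
    _ = 4 ^ u := by
      rw [Real.mul_rpow (by norm_num) hn0.le, mul_left_comm, ← Real.rpow_add hn0]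
      simp

/-- The balance between the size of the integral and the norm of the fooling functions. -/
theorem mul_le_card_of_scales {n : ℕ} (hn : 1 ≤ n) {u : ℝ} (hu : 0 ≤ u) {r e c₀ : ℝ} (hc₀ : 0 < c₀)
    (he : 0 ≤ e) {S : Finset (Fin d → ℕ)} (hS : S.Nonempty)
    (hcard : c₀ * (order n : ℝ) ^ e ≤ (S.card : ℝ) ^ (1 - r)) :
    c₀ / 4 ^ u * ((n : ℝ) ^ (-u) * Real.log n ^ e) *
      (2 ^ (u * order n) * (S.card : ℝ) ^ r) ≤ S.card := by
  have hS0 : (0 : ℝ) < S.card := by exact_mod_cast hS.card_pos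
  have hlog : 0 ≤ Real.log n := Real.log_natCast_nonneg n
  have h4 : (0 : ℝ) < 4 ^ u := by positivity
  calc _ = (1 / 4 ^ u) * ((n : ℝ) ^ (-u) * 2 ^ (u * order n)) *
        ((c₀ * Real.log n ^ e) * (S.card : ℝ) ^ r) := by ring
    _ ≤ (1 / 4 ^ u) * 4 ^ u * ((c₀ * (order n : ℝ) ^ e) * (S.card : ℝ) ^ r) := by
        gcongr
        · exact rpow_neg_mul_two_rpow_order_le hn hu
        · exact log_le_order hn
    _ ≤ (1 / 4 ^ u) * 4 ^ u * ((S.card : ℝ) ^ (1 - r) * (S.card : ℝ) ^ r) := by gcongr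
    _ = S.card := by
        rw [← Real.rpow_add hS0, one_div_mul_cancel h4.ne']
        simp

/-- Lower bound from fooling functions that use all the boxes without nodes. -/
theorem exists_le_optimalError_of_all (hd : 1 ≤ d) {s r : ℝ} (hs : 0 ≤ s) {C : ℝ≥0∞} (hC : C ≠ ⊤)
    {A : Set 𝓢'(Fin d → ℝ, ℂ)} {nrm : 𝓢'(Fin d → ℝ, ℂ) → ℝ≥0∞} (hA : ∀ f, nrm f < ⊤ → f ∈ A)
    (hnrm : ∀ (c : ℝ) (S : Finset (Fin d → ℕ)) (Λ : (Fin d → ℕ) → Finset (Fin d → ℕ)) (M : ℕ),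
      0 ≤ c → (∀ k ∈ S, Λ k ⊆ boxes k) → (∀ k ∈ S, ∑ i, k i = M) →
      nrm (toDistribution (bumpSum c S Λ)) ≤
        C * (ENNReal.ofReal (c * 2 ^ (s * M)) * (S.card : ℝ≥0∞) ^ r)) (hr : 0 ≤ r) :
    ∃ c : ℝ, 0 < c ∧ ∀ n : ℕ, 1 ≤ n →
      ENNReal.ofReal (c * (n : ℝ) ^ (-s) * Real.log n ^ (((d : ℝ) - 1) * max (1 - r) 0)) ≤
        optimalError (continuousPart (supportedInCube A)) (fun f => nrm (toDistribution f)) n := by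
  obtain ⟨c₀, hc₀, hscales⟩ := exists_scales_rpow hd (r := r)
  have hI := integral_bump_pos
  have hd1 : (1 : ℝ) ≤ d := by exact_mod_cast hd
  have he : 0 ≤ ((d : ℝ) - 1) * max (1 - r) 0 := mul_nonneg (by linarith) (le_max_right _ _)
  refine ⟨(∫ x, bump x) ^ d / (C.toReal + 1) * (c₀ / 4 ^ s / 2), by positivity, fun n hn => ?_⟩
  have key := le_optimalError (nrm := nrm) hA (n := n) (b := c₀ / 4 ^ s / 2 *
    ((n : ℝ) ^ (-s) * Real.log n ^ (((d : ℝ) - 1) * max (1 - r) 0))) hC fun x => ?_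
  · convert key using 2
    ring
  · obtain ⟨S, hS, hM, hcard⟩ := hscales (order n) (by simp [order])
    have hS0 : (0 : ℝ) < S.card := by exact_mod_cast hS.card_pos
    -- Since `n < 2 ^ (order n - 1)`, at least half of the boxes of each scale are empty; this half
    -- is the `/ 2` in the constant.
    refine ⟨S, emptyBoxes x, order n, 2 ^ (order n - 1), 2 ^ (s * order n) * (S.card : ℝ) ^ r,
      fun k _ => subset_rfl, hM, fun k hk => ?_, by positivity, fun c hc => ?_, ?_⟩
    · have h1 := two_pow_le_card_emptyBoxes_add x k
      have h2 := two_mul_lt_two_pow_order n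
      rw [hM k hk] at h1
      have h3 : 2 ^ order n = 2 * 2 ^ (order n - 1) := by
        rw [← pow_succ', Nat.sub_add_cancel (by simp [order])]
      omega
    · refine (hnrm c S _ _ hc (fun k _ => emptyBoxes_subset x k) hM).trans_eq ?_
      rw [← mul_assoc c, ENNReal.ofReal_mul (q := (S.card : ℝ) ^ r) (by positivity),
        ← ENNReal.ofReal_rpow_of_nonneg hS0.le hr, ENNReal.ofReal_natCast]
    · have h := mul_le_card_of_scales hn hs hc₀ he hS hcard
      have h3 : (2 : ℝ) ^ order n = 2 * 2 ^ (order n - 1) := by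
        rw [← pow_succ', Nat.sub_add_cancel (by simp [order])]
      have h4 : (((2 ^ (order n - 1) : ℕ) : ℝ) * ((2 : ℝ) ^ order n)⁻¹) = 1 / 2 := by
        rw [h3]
        push_cast
        field_simp
      rw [h4]
      linarith

theorem emptyBoxes_nonempty {n : ℕ} (x : Fin n → unitCube d) {k : Fin d → ℕ}
    (hk : ∑ i, k i = order n) : (emptyBoxes x k).Nonempty := by
  have h1 := two_pow_le_card_emptyBoxes_add x k
  have h2 := two_mul_lt_two_pow_order n
  rw [hk] at h1
  exact Finset.card_pos.1 (by omega)

/-- Lower bound from fooling functions that use one box without nodes for each scale. -/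
theorem exists_le_optimalError_of_single (hd : 1 ≤ d) {s a r : ℝ} (hs : 0 ≤ s - a + 1) {C : ℝ≥0∞}
    (hC : C ≠ ⊤) {A : Set 𝓢'(Fin d → ℝ, ℂ)} {nrm : 𝓢'(Fin d → ℝ, ℂ) → ℝ≥0∞}
    (hA : ∀ f, nrm f < ⊤ → f ∈ A)
    (hnrm : ∀ (c : ℝ) (S : Finset (Fin d → ℕ)) (l : (Fin d → ℕ) → Fin d → ℕ) (M : ℕ),
      0 ≤ c → (∀ k ∈ S, ∑ i, k i = M) →
      nrm (toDistribution (bumpSum c S fun k => {l k})) ≤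
        C * (ENNReal.ofReal (c * 2 ^ ((s - a) * M)) * (S.card : ℝ≥0∞) ^ r)) (hr : 0 ≤ r) :
    ∃ c : ℝ, 0 < c ∧ ∀ n : ℕ, 1 ≤ n →
      ENNReal.ofReal (c * (n : ℝ) ^ (-(s - a + 1)) *
        Real.log n ^ (((d : ℝ) - 1) * max (1 - r) 0)) ≤
        optimalError (continuousPart (supportedInCube A)) (fun f => nrm (toDistribution f)) n := by
  obtain ⟨c₀, hc₀, hscales⟩ := exists_scales_rpow hd (r := r)
  have hI := integral_bump_pos
  have hd1 : (1 : ℝ) ≤ d := by exact_mod_cast hd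
  have he : 0 ≤ ((d : ℝ) - 1) * max (1 - r) 0 := mul_nonneg (by linarith) (le_max_right _ _)
  refine ⟨(∫ x, bump x) ^ d / (C.toReal + 1) * (c₀ / 4 ^ (s - a + 1)), by positivity,
    fun n hn => ?_⟩
  have key := le_optimalError (nrm := nrm) hA (n := n) (b := c₀ / 4 ^ (s - a + 1) *
    ((n : ℝ) ^ (-(s - a + 1)) * Real.log n ^ (((d : ℝ) - 1) * max (1 - r) 0))) hC fun x => ?_
  · convert key using 2
    ring
  · obtain ⟨S, hS, hM, hcard⟩ := hscales (order n) (by simp [order])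
    have hS0 : (0 : ℝ) < S.card := by exact_mod_cast hS.card_pos
    have hex : ∀ k : Fin d → ℕ, ∃ l, k ∈ S → l ∈ emptyBoxes x k := fun k => by
      by_cases hk : k ∈ S
      · obtain ⟨l, hl⟩ := emptyBoxes_nonempty x (hM k hk)
        exact ⟨l, fun _ => hl⟩
      · exact ⟨0, fun h => absurd h hk⟩
    choose l hl using hex
    refine ⟨S, fun k => {l k}, order n, 1, 2 ^ ((s - a) * order n) * (S.card : ℝ) ^ r,
      fun k hk => by simpa using hl k hk, hM, fun k hk => by simp, by positivity,
      fun c hc => ?_, ?_⟩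
    · refine (hnrm c S l _ hc hM).trans_eq ?_
      rw [← mul_assoc c, ENNReal.ofReal_mul (q := (S.card : ℝ) ^ r) (by positivity),
        ← ENNReal.ofReal_rpow_of_nonneg hS0.le hr, ENNReal.ofReal_natCast]
    · have h := mul_le_card_of_scales hn hs hc₀ he hS hcard
      -- One box has volume `2^(-M)`, which shifts the exponent from `s - a` to `s - a + 1`.
      have h2 : (2 : ℝ) ^ ((s - a + 1) * order n) = 2 ^ ((s - a) * order n) * 2 ^ order n := by
        rw [← Real.rpow_natCast 2 (order n), ← Real.rpow_add two_pos]
        ring_nf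
      rw [h2] at h
      rw [Nat.cast_one, one_mul, ← div_eq_mul_inv, le_div_iff₀ (by positivity)]
      refine le_of_eq_of_le ?_ h
      ring

/-! ### Lower bounds for the Besov and Triebel-Lizorkin classes -/

theorem recip_le_one {p : ℝ≥0∞} (hp : 1 ≤ p) : recip p ≤ 1 := by
  have h : 1 / p ≤ 1 := by simpa using hp
  simpa [recip] using ENNReal.toReal_mono ENNReal.one_ne_top h

theorem one_le_recip {p : ℝ≥0∞} (hp0 : p ≠ 0) (hp : p ≤ 1) : 1 ≤ recip p := by
  rw [recip_eq, le_div_iff₀ (ENNReal.toReal_pos hp0 (ne_top_of_le_ne_top ENNReal.one_ne_top hp)),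
    one_mul]
  simpa using ENNReal.toReal_mono ENNReal.one_ne_top hp

theorem recip_nonneg (p : ℝ≥0∞) : 0 ≤ recip p := ENNReal.toReal_nonneg

variable {L : ℕ} (K : LocalMeanKernels L)

theorem exists_le_besovInt_of_one_le (hd : 1 ≤ d) {p θ : ℝ≥0∞} (hθ : θ ≠ 0) {s : ℝ} (hs : 0 < s)
    (hL : s < L + 1) : ∃ c : ℝ, 0 < c ∧ ∀ n : ℕ, 1 ≤ n →
      ENNReal.ofReal (c * (n : ℝ) ^ (-s) *
        Real.log n ^ (((d : ℝ) - 1) * max (1 - recip θ) 0)) ≤ besovInt d K s p θ n := by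
  obtain ⟨C, hC, h⟩ := K.exists_norm_bumpSum_le (d := d) hs hL p hθ
  exact exists_le_optimalError_of_all (A := besovSpace d K s p θ) hd hs.le hC (fun f hf => hf)
    (fun c S Λ M hc hΛ hS => (h c S Λ M hc hΛ hS).1) (recip_nonneg θ)

theorem exists_le_triebelLizorkinInt_of_one_le (hd : 1 ≤ d) {p θ : ℝ≥0∞} (hθ : θ ≠ 0) {s : ℝ}
    (hs : 0 < s) (hL : s < L + 1) : ∃ c : ℝ, 0 < c ∧ ∀ n : ℕ, 1 ≤ n →
      ENNReal.ofReal (c * (n : ℝ) ^ (-s) *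
        Real.log n ^ (((d : ℝ) - 1) * max (1 - recip θ) 0)) ≤ triebelLizorkinInt d K s p θ n := by
  obtain ⟨C, hC, h⟩ := K.exists_norm_bumpSum_le (d := d) hs hL p hθ
  exact exists_le_optimalError_of_all (A := triebelLizorkinSpace d K s p θ) hd hs.le hC
    (fun f hf => hf) (fun c S Λ M hc hΛ hS => (h c S Λ M hc hΛ hS).2) (recip_nonneg θ)

theorem exists_le_besovInt_of_le_one (hd : 1 ≤ d) {p θ : ℝ≥0∞} (hp : p ≠ 0) (hp1 : p ≤ 1)
    (hθ : θ ≠ 0) {s : ℝ} (hs : recip p - 1 < s) (hL : s < L + 1) :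
    ∃ c : ℝ, 0 < c ∧ ∀ n : ℕ, 1 ≤ n →
      ENNReal.ofReal (c * (n : ℝ) ^ (-(s - recip p + 1)) *
        Real.log n ^ (((d : ℝ) - 1) * max (1 - recip θ) 0)) ≤ besovInt d K s p θ n := by
  obtain ⟨C, hC, h⟩ := K.exists_besovNorm_bumpSum_singleton_le (d := d) hL hp hp1 hs hθ
  exact exists_le_optimalError_of_single (A := besovSpace d K s p θ) hd (by linarith) hC
    (fun f hf => hf) h (recip_nonneg θ)

/-- One bump at one scale is enough, since no logarithm is claimed. -/
theorem exists_le_triebelLizorkinInt_of_ne_top (hd : 1 ≤ d) {p θ : ℝ≥0∞} (hp : p ≠ 0)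
    (hpt : p ≠ ⊤) (hθ : θ ≠ 0) {s : ℝ} (hs : recip p - 1 < s) (hL : s < L + 1) :
    ∃ c : ℝ, 0 < c ∧ ∀ n : ℕ, 1 ≤ n →
      ENNReal.ofReal (c * (n : ℝ) ^ (-(s - recip p + 1))) ≤ triebelLizorkinInt d K s p θ n := by
  obtain ⟨C, hC, h⟩ := K.exists_triebelLizorkinNorm_bumpSum_singleton_le (d := d) hL hp hpt hs hθ
  have hI := integral_bump_pos
  set u := s - recip p + 1 with hu
  have hu0 : 0 ≤ u := by linarith
  refine ⟨(∫ x, bump x) ^ d / (C.toReal + 1) * (1 / 4 ^ u), by positivity, fun n hn => ?_⟩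
  have key := le_optimalError (nrm := triebelLizorkinNorm K s p θ)
    (A := triebelLizorkinSpace d K s p θ) (fun f hf => hf) (n := n)
    (b := 1 / 4 ^ u * (n : ℝ) ^ (-u)) hC fun x => ?_
  · rw [mul_assoc]
    exact key
  -- Any scale of order `order n` would do: the norm bound depends on `k` only through its sum.
  · set k : Fin d → ℕ := Pi.single ⟨0, hd⟩ (order n) with hk
    have hM : ∑ i, k i = order n := by simp [hk]
    obtain ⟨l, hl⟩ := emptyBoxes_nonempty x hM
    refine ⟨{k}, fun _ => {l}, order n, 1, 2 ^ ((s - recip p) * order n), by simpa using hl,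
      by simpa using hM, by simp, by positivity, fun c hc => ?_, ?_⟩
    · have := h c k l hc
      rwa [hM] at this
    · have h1 := rpow_neg_mul_two_rpow_order_le hn hu0
      have h2 : (2 : ℝ) ^ (u * order n) = 2 ^ ((s - recip p) * order n) * 2 ^ order n := by
        rw [← Real.rpow_natCast 2 (order n), ← Real.rpow_add two_pos, hu]
        ring_nf
      rw [h2] at h1
      rw [Finset.card_singleton, Nat.cast_one, one_mul, one_mul, ← one_div,
        le_div_iff₀ (by positivity)]
      have h4 : (0 : ℝ) < 4 ^ u := by positivity
      rw [mul_assoc, mul_assoc, one_div_mul_eq_div, div_le_one h4]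
      exact h1

end MixedSmoothness

theorem theorem7p2 (d : ℕ) (hd : 1 ≤ d) (p θ : ℝ≥0∞) (hp : 0 < p) (hθ : 0 < θ) (s : ℝ)
    (hs : max 0 (MixedSmoothness.recip p - 1) < s) (L : ℕ) (hL : s < (L : ℝ) + 1)
    (K : MixedSmoothness.LocalMeanKernels L) :
    (∃ c : ℝ, 0 < c ∧ ∀ n : ℕ, 1 ≤ n →
      ENNReal.ofReal (c * (n : ℝ) ^ (-s + max (MixedSmoothness.recip p - 1) 0) *
        Real.log n ^ (((d : ℝ) - 1) * max (1 - MixedSmoothness.recip θ) 0)) ≤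
        MixedSmoothness.besovInt d K s p θ n) ∧
    (1 ≤ p → p < ⊤ → ∃ c : ℝ, 0 < c ∧ ∀ n : ℕ, 1 ≤ n →
      ENNReal.ofReal (c * (n : ℝ) ^ (-s) *
        Real.log n ^ (((d : ℝ) - 1) * max (1 - MixedSmoothness.recip θ) 0)) ≤
        MixedSmoothness.triebelLizorkinInt d K s p θ n) ∧
    (p < 1 → ∃ c : ℝ, 0 < c ∧ ∀ n : ℕ, 1 ≤ n →
      ENNReal.ofReal (c * (n : ℝ) ^ (-s + MixedSmoothness.recip p - 1)) ≤
        MixedSmoothness.triebelLizorkinInt d K s p θ n) := by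
  obtain ⟨hs0, hsp⟩ := max_lt_iff.1 hs
  refine ⟨?_, fun _ _ =>
    MixedSmoothness.exists_le_triebelLizorkinInt_of_one_le K hd hθ.ne' hs0 hL, fun hp1 => ?_⟩
  · rcases le_total 1 p with hp1 | hp1
    · rw [max_eq_right (by linarith [MixedSmoothness.recip_le_one hp1]), add_zero]
      exact MixedSmoothness.exists_le_besovInt_of_one_le K hd hθ.ne' hs0 hL
    · rw [max_eq_left (by linarith [MixedSmoothness.one_le_recip hp.ne' hp1]),
        show -s + (MixedSmoothness.recip p - 1) = -(s - MixedSmoothness.recip p + 1) by ring]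
      exact MixedSmoothness.exists_le_besovInt_of_le_one K hd hp.ne' hp1 hθ.ne' hsp hL
  · rw [show -s + MixedSmoothness.recip p - 1 = -(s - MixedSmoothness.recip p + 1) by ring]
    exact MixedSmoothness.exists_le_triebelLizorkinInt_of_ne_top K hd hp.ne'
      (hp1.trans_le le_top).ne hθ.ne' hsp hL
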